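/- **Theorem (eight-dimensional symplectic filiform real Lie groups).** A Lie algebra $\mathfrak g$ is *filiform* if it is nilpotent of nilpotency class $\dim\mathfrak g-1$. Let $G$ be a connected, simply connected real Lie group of dimension $8$ whose Lie algebra is filiform, and suppose that $G$ carries a left-invariant symplectic form. Then $G$ is isomorphic to a Lie group whose Lie algebra is one of those in the list below, that is, the Lie algebra of $G$ is isomorphic to an algebra of the list. Moreover every Lie algebra in the list is filiform, and the indicated $2$-form is a symplectic form on it (non-degenerate, skew-symmetric, and closed: $\omega(x,[y,z])+\omega(y,[z,x])+\omega(z,[x,y])=0$). The algebras have a basis $e_1,\dots,e_8$ with dual basis $e^1,\dots,e^8$, and $e^{ij}=e^i\wedge e^j$. All parameters are real, and the brackets $[e_i,e_j]$, $i<j$, that are not listed vanish. In all cases $$\omega=\kappa_1e^{13}+e^{15}+\kappa_2e^{23}+e^{26}+e^{37}+e^{48}.$$ 1. $\mathfrak g_{8,80}^{a,b,c,d,\lambda,\mu,\mu_1}$. Here $\nu$ is a real number with $\nu(\mu-1)=\mu_1-\mu$ (so $\nu=\frac{\mu_1-\mu}{\mu-1}$ if $\mu\neq1$) and $2\mu(\nu+1)=\nu(3\nu+5)$;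 moreover $\mu\ne0$ and $b(\nu+1)(\mu+1)\neq0$. Brackets: $[e_1,e_2]=(\nu\lambda-d)e_5+(\mu_1-1)a\,e_6+\nu b\,e_7+c\,e_8$, $[e_1,e_3]=(\mu+1)a\,e_5-\nu(\nu+1)b\,e_6+d\,e_8$, $[e_1,e_4]=-e_2+\lambda e_7$, $[e_2,e_3]=-\nu(\nu+2)b\,e_5-(\mu+1)a\,e_8$, $[e_2,e_4]=-e_3-(\mu+1)a\,e_7$, $[e_3,e_4]=(\nu+2)b\,e_7$, $[e_1,e_6]=-\mu e_8$, $[e_1,e_7]=-\mu_1e_5$, $[e_2,e_7]=-\nu e_8$, $[e_4,e_5]=-e_8$, $[e_4,e_6]=-(\mu+1)e_5$, $[e_4,e_7]=-(\nu+1)e_6$. Form: $\kappa_1=c$, $\kappa_2=d-\lambda$. 2. $\mathfrak g_{8,90}^{a,b,c,d,\lambda}$, $\lambda\neq0$: $[e_1,e_2]=-a e_5+b e_6-c e_8$, $[e_1,e_3]=-b e_5+a e_8$, $[e_1,e_4]=-e_2+d e_7$, $[e_2,e_3]=b e_8$, $[e_2,e_4]=-e_3+b e_7$, $[e_3,e_4]=\lambda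 e_7$, $[e_4,e_5]=-e_8$, $[e_4,e_6]=-e_5$, $[e_4,e_7]=-e_6$. Form: $\kappa_1=-c$, $\kappa_2=a-d$. 3. $\mathfrak g_{8,91}^{a,b,c,d,\lambda}$, $b-d\neq0$: $[e_1,e_2]=a e_5+b e_6$, $[e_1,e_3]=-b e_5$, $[e_1,e_4]=-e_2+\lambda e_7$, $[e_2,e_3]=d e_8$, $[e_2,e_4]=-e_3-a e_7$, $[e_3,e_4]=c e_5-(a+d)e_6+(b-d)e_7$, $[e_1,e_7]=-e_8$, $[e_4,e_5]=-e_8$, $[e_4,e_6]=-e_5$, $[e_4,e_7]=-e_5-e_6$. Form: $\kappa_1=0$, $\kappa_2=c-\lambda$. 4. $\mathfrak g_{8,93}^{a,b,c,d,\lambda}$, $b\neq0$: $[e_1,e_2]=-a e_6-b e_7$, $[e_1,e_3]=-\frac23b\,e_6-c\,e_8$, $[e_1,e_4]=-e_2+\frac35c\,e_7$, $[e_2,e_3]=\frac13b\,e_5$, $[e_2,e_4]=-e_3+\frac35a\,e_7$, $[e_3,e_4]=-d e_5+\frac35a\,e_6+\frac15b\,e_7+\lambda e_8$, $[e_1,e_7]=-\frac53e_5$,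 $[e_2,e_7]=\frac53e_8$, $[e_4,e_5]=-e_8$, $[e_4,e_6]=-e_5$, $[e_4,e_7]=\frac23e_6$. Form: $\kappa_1=0$, $\kappa_2=-d-\frac{8c}5$. 5. $\mathfrak g_{8,95}^{a,b,c,d,\lambda}$, $b\neq0$: $[e_1,e_2]=-a e_6-b e_7$, $[e_1,e_3]=-\frac23b\,e_6-c\,e_8$, $[e_1,e_4]=-e_2+\left(\frac35a-b+\frac35c\right)e_7$, $[e_2,e_3]=\frac13b\,e_5+\frac13b\,e_8$, $[e_2,e_4]=-e_3+\left(\frac35a-b\right)e_7$, $[e_3,e_4]=-d e_5+\left(\frac35a-\frac43b\right)e_6+\frac15b\,e_7+\lambda e_8$, $[e_1,e_7]=-\frac53e_5+\frac53e_8$, $[e_2,e_7]=\frac53e_8$, $[e_4,e_5]=-e_8$, $[e_4,e_6]=-e_5$, $[e_4,e_7]=\frac53e_5+\frac23e_6$. Form: $\kappa_1=0$, $\kappa_2=b-d-\frac15(3a+8c)$. -/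

import Mathlib

open scoped Manifold ContDiff

noncomputable section

namespace SympFiliform

/-! ### Filiform and symplectic Lie algebras -/

/-- A Lie algebra is filiform if it is nilpotent and its nilpotency class is `dim L - 1`. -/
def IsFiliform (L : Type*) [LieRing L] [LieAlgebra ℝ L] : Prop :=
  LieRing.IsNilpotent L ∧ LieModule.nilpotencyLength L L + 1 = Module.finrank ℝ L

/-- A symplectic form on a Lie algebra: a non-degenerate, skew-symmetric bilinear form which is
closed for the Chevalley-Eilenberg differential. -/
structure IsSymplecticForm {L : Type*} [LieRing L] [LieAlgebra ℝ L]
    (w : LinearMap.BilinForm ℝ L) : Prop where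
  isAlt : w.IsAlt
  nondegenerate : w.Nondegenerate
  closed : ∀ x y z : L, w x ⁅y, z⁆ + w y ⁅z, x⁆ + w z ⁅x, y⁆ = 0

/-! ### Symplectic Lie groups -/

section Group

variable {E : Type*} [NormedAddCommGroup E] [NormedSpace ℝ E]
  {H : Type*} [TopologicalSpace H] {I : ModelWithCorners ℝ E H}
  {G : Type*} [TopologicalSpace G] [ChartedSpace H G] [Group G]

/-- A smooth Lie group satisfies the differentiability assumption under which Mathlib puts the
Lie algebra structure on `GroupLieAlgebra I G`, the tangent space at the identity with the bracket
of left-invariant vector fields. -/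
instance lieGroup_minSmoothness [LieGroup I ∞ G] : LieGroup I (minSmoothness ℝ 3) G := by
  rw [minSmoothness_of_isRCLikeNormedField]
  infer_instance

/-- The derivative of the function `f` along the vector field `X`, at the point `g`. -/
def derivAlong (X : ∀ g : G, TangentSpace I g) (f : G → ℝ) (g : G) : ℝ :=
  mfderiv I 𝓘(ℝ, ℝ) f g (X g)

open VectorField in
/-- The value at `g` of the exterior derivative of a `2`-form `Ω` on three vector fields, by the
invariant formula
`dΩ(X,Y,Z) = X Ω(Y,Z) - Y Ω(X,Z) + Z Ω(X,Y) - Ω([X,Y],Z) + Ω([X,Z],Y) - Ω([Y,Z],X)`. -/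
def extDerivApply (Ω : ∀ g : G, LinearMap.BilinForm ℝ (TangentSpace I g))
    (X Y Z : ∀ g : G, TangentSpace I g) (g : G) : ℝ :=
  derivAlong X (fun p => Ω p (Y p) (Z p)) g
    - derivAlong Y (fun p => Ω p (X p) (Z p)) g
    + derivAlong Z (fun p => Ω p (X p) (Y p)) g
    - Ω g (mlieBracket I X Y g) (Z g)
    + Ω g (mlieBracket I X Z g) (Y g)
    - Ω g (mlieBracket I Y Z g) (X g)

/-- `Ω` is a left-invariant symplectic form on the Lie group `G`: a field of non-degenerate
skew-symmetric bilinear forms on the tangent spaces of `G`, invariant under left translations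
(hence smooth) and closed. -/
structure IsLeftInvariantSymplecticForm [LieGroup I ∞ G]
    (Ω : ∀ g : G, LinearMap.BilinForm ℝ (TangentSpace I g)) : Prop where
  isAlt : ∀ g, (Ω g).IsAlt
  nondegenerate : ∀ g, (Ω g).Nondegenerate
  leftInvariant : ∀ (h g : G) (v w : TangentSpace I g),
    Ω (h * g) (mfderiv I I (fun p : G => h * p) g v) (mfderiv I I (fun p : G => h * p) g w)
      = Ω g v w
  closed : ∀ X Y Z : (∀ g : G, TangentSpace I g),
    ContMDiff I I.tangent 1 (fun g => (⟨g, X g⟩ : TangentBundle I G)) →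
    ContMDiff I I.tangent 1 (fun g => (⟨g, Y g⟩ : TangentBundle I G)) →
    ContMDiff I I.tangent 1 (fun g => (⟨g, Z g⟩ : TangentBundle I G)) →
    ∀ g, extDerivApply Ω X Y Z g = 0

end Group

/-! ### The list

The eight coordinates are indexed by `Fin 8`, written with the labels `1, …, 8`; the label `8` is
the element `0` of `Fin 8`. -/

/-- The basis vector `e_k`. -/
def e (k : Fin 8) : Fin 8 → ℝ := Pi.single k 1

/-- The `2`-form `e^{ij} = e^i ∧ e^j` on `ℝ⁸`. -/
def ee (i j : Fin 8) (x y : Fin 8 → ℝ) : ℝ := x i * y j - x j * y i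

/-- The entries of the list, with their parameters and the restrictions on them. In the first
family, `ν` is `(μ₁ - μ) / (μ - 1)` as soon as `μ ≠ 1`. -/
inductive Entry : Type
  | g80 (a b c d l μ μ₁ ν : ℝ) (hν : ν * (μ - 1) = μ₁ - μ)
      (hrel : 2 * μ * (ν + 1) = ν * (3 * ν + 5)) (hμ : μ ≠ 0)
      (hb : b * (ν + 1) * (μ + 1) ≠ 0) : Entry
  | g90 (a b c d l : ℝ) (hl : l ≠ 0) : Entry
  | g91 (a b c d l : ℝ) (hbd : b - d ≠ 0) : Entry
  | g93 (a b c d l : ℝ) (hb : b ≠ 0) : Entry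
  | g95 (a b c d l : ℝ) (hb : b ≠ 0) : Entry

/-- The bracket of an entry: the summand `ee i j x y • v` says that `[e_i, e_j] = v`, and
all brackets `[e_i, e_j]`, `i < j`, that are not mentioned vanish. -/
def Entry.bracket (x y : Fin 8 → ℝ) : Entry → (Fin 8 → ℝ)
  | .g80 a b c d l μ μ₁ ν _ _ _ _ =>
      ee 1 2 x y • ((ν * l - d) • e 5 + ((μ₁ - 1) * a) • e 6 + (ν * b) • e 7 + c • e 8)
    + ee 1 3 x y • (((μ + 1) * a) • e 5 - (ν * (ν + 1) * b) • e 6 + d • e 8)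
    + ee 1 4 x y • (-e 2 + l • e 7)
    + ee 2 3 x y • (-(ν * (ν + 2) * b) • e 5 - ((μ + 1) * a) • e 8)
    + ee 2 4 x y • (-e 3 - ((μ + 1) * a) • e 7)
    + ee 3 4 x y • (((ν + 2) * b) • e 7)
    + ee 1 6 x y • (-μ • e 8)
    + ee 1 7 x y • (-μ₁ • e 5)
    + ee 2 7 x y • (-ν • e 8)
    + ee 4 5 x y • (-e 8)
    + ee 4 6 x y • (-(μ + 1) • e 5)
    + ee 4 7 x y • (-(ν + 1) • e 6)
  | .g90 a b c d l _ =>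
      ee 1 2 x y • (-a • e 5 + b • e 6 - c • e 8)
    + ee 1 3 x y • (-b • e 5 + a • e 8)
    + ee 1 4 x y • (-e 2 + d • e 7)
    + ee 2 3 x y • (b • e 8)
    + ee 2 4 x y • (-e 3 + b • e 7)
    + ee 3 4 x y • (l • e 7)
    + ee 4 5 x y • (-e 8)
    + ee 4 6 x y • (-e 5)
    + ee 4 7 x y • (-e 6)
  | .g91 a b c d l _ =>
      ee 1 2 x y • (a • e 5 + b • e 6)
    + ee 1 3 x y • (-b • e 5)
    + ee 1 4 x y • (-e 2 + l • e 7)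
    + ee 2 3 x y • (d • e 8)
    + ee 2 4 x y • (-e 3 - a • e 7)
    + ee 3 4 x y • (c • e 5 - (a + d) • e 6 + (b - d) • e 7)
    + ee 1 7 x y • (-e 8)
    + ee 4 5 x y • (-e 8)
    + ee 4 6 x y • (-e 5)
    + ee 4 7 x y • (-e 5 - e 6)
  | .g93 a b c d l _ =>
      ee 1 2 x y • (-a • e 6 - b • e 7)
    + ee 1 3 x y • (-(2 / 3 * b) • e 6 - c • e 8)
    + ee 1 4 x y • (-e 2 + (3 / 5 * c) • e 7)
    + ee 2 3 x y • ((1 / 3 * b) • e 5)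
    + ee 2 4 x y • (-e 3 + (3 / 5 * a) • e 7)
    + ee 3 4 x y • (-d • e 5 + (3 / 5 * a) • e 6 + (1 / 5 * b) • e 7 + l • e 8)
    + ee 1 7 x y • (-(5 / 3 : ℝ) • e 5)
    + ee 2 7 x y • ((5 / 3 : ℝ) • e 8)
    + ee 4 5 x y • (-e 8)
    + ee 4 6 x y • (-e 5)
    + ee 4 7 x y • ((2 / 3 : ℝ) • e 6)
  | .g95 a b c d l _ =>
      ee 1 2 x y • (-a • e 6 - b • e 7)
    + ee 1 3 x y • (-(2 / 3 * b) • e 6 - c • e 8)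
    + ee 1 4 x y • (-e 2 + (3 / 5 * a - b + 3 / 5 * c) • e 7)
    + ee 2 3 x y • ((1 / 3 * b) • e 5 + (1 / 3 * b) • e 8)
    + ee 2 4 x y • (-e 3 + (3 / 5 * a - b) • e 7)
    + ee 3 4 x y • (-d • e 5 + (3 / 5 * a - 4 / 3 * b) • e 6 + (1 / 5 * b) • e 7 + l • e 8)
    + ee 1 7 x y • (-(5 / 3 : ℝ) • e 5 + (5 / 3 : ℝ) • e 8)
    + ee 2 7 x y • ((5 / 3 : ℝ) • e 8)
    + ee 4 5 x y • (-e 8)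
    + ee 4 6 x y • (-e 5)
    + ee 4 7 x y • ((5 / 3 : ℝ) • e 5 + (2 / 3 : ℝ) • e 6)

/-- The parameters `(κ₁, κ₂)` of the symplectic form of an entry. -/
def Entry.kappa : Entry → ℝ × ℝ
  | .g80 _ _ c d l _ _ _ _ _ _ _ => (c, d - l)
  | .g90 a _ c d _ _ => (-c, a - d)
  | .g91 _ _ c _ l _ => (0, c - l)
  | .g93 _ _ c d _ _ => (0, -d - 8 * c / 5)
  | .g95 a b c d _ _ => (0, b - d - 1 / 5 * (3 * a + 8 * c))

/-- The underlying space of the Lie algebra of an entry. -/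
def Entry.Algebra (_R : Entry) : Type := Fin 8 → ℝ

instance (R : Entry) : AddCommGroup R.Algebra := inferInstanceAs (AddCommGroup (Fin 8 → ℝ))

instance (R : Entry) : Module ℝ R.Algebra := inferInstanceAs (Module ℝ (Fin 8 → ℝ))

theorem ee_add_left (i j : Fin 8) (x y z : Fin 8 → ℝ) :
    ee i j (x + y) z = ee i j x z + ee i j y z := by simp [ee]; ring

theorem ee_add_right (i j : Fin 8) (x y z : Fin 8 → ℝ) :
    ee i j x (y + z) = ee i j x y + ee i j x z := by simp [ee]; ring

theorem ee_smul_right (i j : Fin 8) (t : ℝ) (x y : Fin 8 → ℝ) :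
    ee i j x (t • y) = t * ee i j x y := by simp [ee]; ring

theorem ee_smul_left (i j : Fin 8) (t : ℝ) (x y : Fin 8 → ℝ) :
    ee i j (t • x) y = t * ee i j x y := by simp [ee]; ring

theorem ee_self (i j : Fin 8) (x : Fin 8 → ℝ) : ee i j x x = 0 := by simp [ee]; ring

theorem Entry.bracket_add_left (R : Entry) (x y z : Fin 8 → ℝ) :
    R.bracket (x + y) z = R.bracket x z + R.bracket y z := by
  cases R <;> simp only [Entry.bracket, ee_add_left, add_smul] <;> abel

theorem Entry.bracket_add_right (R : Entry) (x y z : Fin 8 → ℝ) :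
    R.bracket x (y + z) = R.bracket x y + R.bracket x z := by
  cases R <;> simp only [Entry.bracket, ee_add_right, add_smul] <;> abel

theorem Entry.bracket_smul_right (R : Entry) (t : ℝ) (x y : Fin 8 → ℝ) :
    R.bracket x (t • y) = t • R.bracket x y := by
  cases R <;> simp only [Entry.bracket, ee_smul_right, mul_smul, smul_add]

theorem Entry.bracket_self (R : Entry) (x : Fin 8 → ℝ) : R.bracket x x = 0 := by
  cases R <;> simp only [Entry.bracket, ee_self, zero_smul, add_zero]

set_option maxHeartbeats 1000000 in
theorem Entry.leibniz (R : Entry) (x y z : Fin 8 → ℝ) :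
    R.bracket x (R.bracket y z) = R.bracket (R.bracket x y) z + R.bracket y (R.bracket x z) := by
  cases R with
  | g80 a b c d l μ μ₁ ν hν hrel hμ hb =>
    generalize hB : (fun x y => Entry.bracket x y (.g80 a b c d l μ μ₁ ν hν hrel hμ hb)) = B
    have h : ∀ x y, B x y = ![
        ee 1 2 x y * c + ee 1 3 x y * d - ee 2 3 x y * ((μ + 1) * a) - ee 1 6 x y * μ
          - ee 2 7 x y * ν - ee 4 5 x y,
        0, - ee 1 4 x y, - ee 2 4 x y, 0,
        ee 1 2 x y * (ν * l - d) + ee 1 3 x y * ((μ + 1) * a) - ee 2 3 x y * (ν * (ν + 2) * b)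
          - ee 1 7 x y * μ₁ - ee 4 6 x y * (μ + 1),
        ee 1 2 x y * ((μ₁ - 1) * a) - ee 1 3 x y * (ν * (ν + 1) * b) - ee 4 7 x y * (ν + 1),
        ee 1 2 x y * (ν * b) + ee 1 4 x y * l - ee 2 4 x y * ((μ + 1) * a)
          + ee 3 4 x y * ((ν + 2) * b)] := by
      intro x y
      subst hB
      ext k
      fin_cases k <;> simp [Entry.bracket, e] <;> ring
    have h' : B x (B y z) = B (B x y) z + B y (B x z) := by
      ext k
      obtain rfl : μ₁ = ν * (μ - 1) + μ := by linarith
      fin_cases k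
      pick_goal 6
      · simp [h, ee]
        linear_combination -(b * (x 1 * (y 3 * z 4 - y 4 * z 3) - x 3 * (y 1 * z 4 - y 4 * z 1)
          + x 4 * (y 1 * z 3 - y 3 * z 1))) * hrel
      all_goals simp [h, ee]
      all_goals ring
    subst hB
    exact h'
  | g90 a b c d l hl =>
    generalize hB : (fun x y => Entry.bracket x y (.g90 a b c d l hl)) = B
    have h : ∀ x y, B x y = ![
        -(ee 1 2 x y * c) + ee 1 3 x y * a + ee 2 3 x y * b - ee 4 5 x y,
        0, - ee 1 4 x y, - ee 2 4 x y, 0,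
        -(ee 1 2 x y * a) - ee 1 3 x y * b - ee 4 6 x y,
        ee 1 2 x y * b - ee 4 7 x y,
        ee 1 4 x y * d + ee 2 4 x y * b + ee 3 4 x y * l] := by
      intro x y
      subst hB
      ext k
      fin_cases k <;> simp [Entry.bracket, e] <;> ring
    have h' : B x (B y z) = B (B x y) z + B y (B x z) := by
      ext k
      fin_cases k <;> simp [h, ee] <;> ring
    subst hB
    exact h'
  | g91 a b c d l hbd =>
    generalize hB : (fun x y => Entry.bracket x y (.g91 a b c d l hbd)) = B
    have h : ∀ x y, B x y = ![
        ee 2 3 x y * d - ee 1 7 x y - ee 4 5 x y,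
        0, - ee 1 4 x y, - ee 2 4 x y, 0,
        ee 1 2 x y * a - ee 1 3 x y * b + ee 3 4 x y * c - ee 4 6 x y - ee 4 7 x y,
        ee 1 2 x y * b - ee 3 4 x y * (a + d) - ee 4 7 x y,
        ee 1 4 x y * l - ee 2 4 x y * a + ee 3 4 x y * (b - d)] := by
      intro x y
      subst hB
      ext k
      fin_cases k <;> simp [Entry.bracket, e] <;> ring
    have h' : B x (B y z) = B (B x y) z + B y (B x z) := by
      ext k
      fin_cases k <;> simp [h, ee] <;> ring
    subst hB
    exact h'
  | g93 a b c d l hb =>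
    generalize hB : (fun x y => Entry.bracket x y (.g93 a b c d l hb)) = B
    have h : ∀ x y, B x y = ![
        -(ee 1 3 x y * c) + ee 3 4 x y * l + ee 2 7 x y * (5 / 3) - ee 4 5 x y,
        0, - ee 1 4 x y, - ee 2 4 x y, 0,
        ee 2 3 x y * (1 / 3 * b) - ee 3 4 x y * d - ee 1 7 x y * (5 / 3) - ee 4 6 x y,
        -(ee 1 2 x y * a) - ee 1 3 x y * (2 / 3 * b) + ee 3 4 x y * (3 / 5 * a) + ee 4 7 x y * (2 / 3),
        -(ee 1 2 x y * b) + ee 1 4 x y * (3 / 5 * c) + ee 2 4 x y * (3 / 5 * a)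
          + ee 3 4 x y * (1 / 5 * b)] := by
      intro x y
      subst hB
      ext k
      fin_cases k <;> simp [Entry.bracket, e] <;> ring
    have h' : B x (B y z) = B (B x y) z + B y (B x z) := by
      ext k
      fin_cases k <;> simp [h, ee] <;> ring
    subst hB
    exact h'
  | g95 a b c d l hb =>
    generalize hB : (fun x y => Entry.bracket x y (.g95 a b c d l hb)) = B
    have h : ∀ x y, B x y = ![
        -(ee 1 3 x y * c) + ee 2 3 x y * (1 / 3 * b) + ee 3 4 x y * l + ee 1 7 x y * (5 / 3)
          + ee 2 7 x y * (5 / 3) - ee 4 5 x y,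
        0, - ee 1 4 x y, - ee 2 4 x y, 0,
        ee 2 3 x y * (1 / 3 * b) - ee 3 4 x y * d - ee 1 7 x y * (5 / 3) - ee 4 6 x y
          + ee 4 7 x y * (5 / 3),
        -(ee 1 2 x y * a) - ee 1 3 x y * (2 / 3 * b) + ee 3 4 x y * (3 / 5 * a - 4 / 3 * b)
          + ee 4 7 x y * (2 / 3),
        -(ee 1 2 x y * b) + ee 1 4 x y * (3 / 5 * a - b + 3 / 5 * c)
          + ee 2 4 x y * (3 / 5 * a - b) + ee 3 4 x y * (1 / 5 * b)] := by
      intro x y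
      subst hB
      ext k
      fin_cases k <;> simp [Entry.bracket, e] <;> ring
    have h' : B x (B y z) = B (B x y) z + B y (B x z) := by
      ext k
      fin_cases k <;> simp [h, ee] <;> ring
    subst hB
    exact h'

instance (R : Entry) : LieRing R.Algebra where
  bracket x y := R.bracket x y
  add_lie x y z := R.bracket_add_left x y z
  lie_add x y z := R.bracket_add_right x y z
  lie_self x := R.bracket_self x
  leibniz_lie x y z := R.leibniz x y z

instance (R : Entry) : LieAlgebra ℝ R.Algebra where
  lie_smul t x y := R.bracket_smul_right t x y

/-- The `2`-form `e^{ij}` as a bilinear form on the Lie algebra of an entry. -/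
def Entry.eeForm (R : Entry) (i j : Fin 8) : LinearMap.BilinForm ℝ R.Algebra :=
  LinearMap.mk₂ ℝ (fun x y => ee i j x y)
    (fun x y z => ee_add_left i j x y z) (fun t x y => ee_smul_left i j t x y)
    (fun x y z => ee_add_right i j x y z) (fun t x y => ee_smul_right i j t x y)

/-- The symplectic form `κ₁ e^{13} + e^{15} + κ₂ e^{23} + e^{26} + e^{37} + e^{48}` of an entry. -/
def Entry.form (R : Entry) : LinearMap.BilinForm ℝ R.Algebra :=
  R.kappa.1 • R.eeForm 1 3 + R.eeForm 1 5 + R.kappa.2 • R.eeForm 2 3 + R.eeForm 2 6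
    + R.eeForm 3 7 + R.eeForm 4 8

end SympFiliform

end

/-! On left-invariant fields an invariant 2-form is constant, so its value at the identity is a
symplectic form `w` on the Lie algebra, and the classification becomes a question about
eight-dimensional filiform algebras.

The lower central series of such an algebra has dimensions 8, 6, 5, …, 0, and a generic `X 0` maps
each graded piece onto the next. Iterating `ad (X 0)` on a suitable `X 1` gives a basis, and the
Jacobi identity with `X 0` reduces all brackets to `[X 1, X 2]`, `[X 2, X 3]` and `[X 3, X 4]`. A
further Jacobi identity removes the `X 5`-term of `[X 2, X 3]`, and the symplectic form forces `[X
3, X 4] = 0` (`IsFiliform.exists_isFiliformChain`). Six constants α, β, a₅, a₆, a₇, δ remain, and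
they determine the algebra (`nonempty_lieEquiv`).

For such a chain `w (X i) (X j) = 0` whenever `i, j ≥ 1` and `i + j ≥ 8`, so nondegeneracy makes the
antidiagonal entries nonzero. Closedness relates these entries linearly, which forces α = β = 0 or
excludes a few ratios α : β (`eq_zero_or_ne_zero`).

The remaining freedom used is rescaling the generators (`scale`) and replacing `X 0` by `X 0 + t • X
1` (`exists_shift`). If α = β = 0, the algebra is in `g90` or `g91` according to whether a₅ = δ. If
α = 2β ≠ 0, it is in `g93` or `g95` according to whether 3a₅ - 8δ vanishes. All other admissible
ratios are those of `g80`, with ν = -(β + 2α)/(3β).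

Conversely, in every entry `e 4` and `e 1` generate a chain. This shows that the entries are
filiform and provides the targets of the isomorphisms. -/

noncomputable section

namespace SympFiliform

/-! ### From the Lie group to its Lie algebra. -/

section LieGroupForm

variable {E : Type*} [NormedAddCommGroup E] [NormedSpace ℝ E]
  {H : Type*} [TopologicalSpace H] {I : ModelWithCorners ℝ E H}
  {G : Type*} [TopologicalSpace G] [ChartedSpace H G] [Group G]

theorem contMDiff_one_mulInvariantVectorField [LieGroup I ∞ G] (v : GroupLieAlgebra I G) :
    ContMDiff I I.tangent 1
      (fun g => (⟨g, mulInvariantVectorField v g⟩ : TangentBundle I G)) := by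
  refine (contMDiff_mulInvariantVectorField (I := I) (G := G) v).of_le ?_
  rw [minSmoothness_of_isRCLikeNormedField]
  norm_num

theorem mulInvariantVectorField_one (v : GroupLieAlgebra I G) :
    mulInvariantVectorField v (1 : G) = v := by
  have h : (fun p : G => 1 * p) = id := by ext; simp
  simp only [mulInvariantVectorField]
  rw [h, mfderiv_id]
  rfl

variable [LieGroup I ∞ G] {Ω : ∀ g : G, LinearMap.BilinForm ℝ (TangentSpace I g)}

theorem IsLeftInvariantSymplecticForm.apply_mulInvariantVectorField
    (hΩ : IsLeftInvariantSymplecticForm Ω) (v w : GroupLieAlgebra I G) (g : G) :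
    Ω g (mulInvariantVectorField v g) (mulInvariantVectorField w g) = Ω 1 v w := by
  have h := hΩ.leftInvariant g 1 v w
  -- Invariance lands at the point `g * 1`; generalizing that point allows it to be replaced by `g`
  -- inside dependent types.
  have key : ∀ g' : G, g' = g * 1 →
      Ω g' (mfderiv I I (fun p : G => g * p) 1 v) (mfderiv I I (fun p : G => g * p) 1 w)
      = Ω 1 v w := by
    rintro _ rfl
    exact h
  exact key g (mul_one g).symm

/-- The value at the identity of a left-invariant symplectic form is a symplectic form on the Lie
algebra. -/
theorem IsLeftInvariantSymplecticForm.isSymplecticForm_one [CompleteSpace E]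
    (hΩ : IsLeftInvariantSymplecticForm Ω) :
    IsSymplecticForm (L := GroupLieAlgebra I G) (Ω 1) where
  isAlt := hΩ.isAlt 1
  nondegenerate := hΩ.nondegenerate 1
  closed x y z := by
    have h := hΩ.closed _ _ _ (contMDiff_one_mulInvariantVectorField x)
      (contMDiff_one_mulInvariantVectorField y) (contMDiff_one_mulInvariantVectorField z) 1
    -- On left-invariant fields `Ω` takes constant values, so only the three bracket terms of the
    -- exterior derivative survive.
    have hd : ∀ (V : ∀ g : G, TangentSpace I g) (c : ℝ),
        derivAlong V (fun _ : G => c) 1 = 0 := by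
      intro V c
      simp only [derivAlong, mfderiv_const]
      rfl
    simp only [extDerivApply, hΩ.apply_mulInvariantVectorField, hd,
      mulInvariantVectorField_one, ← GroupLieAlgebra.bracket_def] at h
    have hs := fun u v : GroupLieAlgebra I G => (hΩ.isAlt 1).neg_eq u v
    have hzx : (⁅z, x⁆ : GroupLieAlgebra I G) = -⁅x, z⁆ := (lie_skew _ _).symm
    have h1 := hs x ⁅y, z⁆
    have h2 := hs y ⁅x, z⁆
    have h3 := hs z ⁅x, y⁆
    rw [hzx]
    have h4 : Ω 1 y (-⁅x, z⁆ : GroupLieAlgebra I G) = - Ω 1 y ⁅x, z⁆ := map_neg _ _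
    rw [h4]
    linarith

end LieGroupForm

/-! ### Chains and their structure constants. -/

theorem lie_lie_right {L : Type*} [LieRing L] (x u v : L) :
    ⁅u, ⁅x, v⁆⁆ = ⁅x, ⁅u, v⁆⁆ - ⁅⁅x, u⁆, v⁆ := by
  rw [leibniz_lie x u v]; abel

section Chain

variable {L : Type*} [LieRing L] [LieAlgebra ℝ L]

/-- Applying `ad (X 0)` six times to a linear relation isolates the coefficient of `X 1`; going back
one application at a time gives those of `X 2`, …, `X 6`. The last two coefficients are separated by
bracketing with `X 6`, since `[X 0, X 6] = X 7` and `[X 7, X 6] = 0`. -/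
theorem linearIndependent_of_lie {X : Fin 8 → L} (h01 : ⁅X 0, X 1⁆ = X 2) (h02 : ⁅X 0, X 2⁆ = X 3)
    (h03 : ⁅X 0, X 3⁆ = X 4) (h04 : ⁅X 0, X 4⁆ = X 5) (h05 : ⁅X 0, X 5⁆ = X 6)
    (h06 : ⁅X 0, X 6⁆ = X 7) (h07 : ⁅X 0, X 7⁆ = 0) (h67 : ⁅X 6, X 7⁆ = 0) (hX : X 7 ≠ 0) :
    LinearIndependent ℝ X := by
  have hX7 : ∀ c : ℝ, c • X 7 = 0 → c = 0 := fun c hc =>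
    (smul_eq_zero.mp hc).resolve_right hX
  rw [Fintype.linearIndependent_iff]
  intro g hg
  simp only [Fin.sum_univ_eight] at hg
  have ad : ∀ u : L, u = 0 → ⁅X 0, u⁆ = 0 := by rintro _ rfl; simp
  have h1 := ad _ hg
  simp only [lie_add, lie_smul, lie_self, h01, h02, h03, h04, h05, h06,
    h07, smul_zero, zero_add, add_zero] at h1
  have h2 := ad _ h1
  simp only [lie_add, lie_smul, h02, h03, h04, h05, h06,
    h07, smul_zero, add_zero] at h2
  have h3 := ad _ h2
  simp only [lie_add, lie_smul, h03, h04, h05, h06,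
    h07, smul_zero, add_zero] at h3
  have h4 := ad _ h3
  simp only [lie_add, lie_smul, h04, h05, h06,
    h07, smul_zero, add_zero] at h4
  have h5 := ad _ h4
  simp only [lie_add, lie_smul, h05, h06,
    h07, smul_zero, add_zero] at h5
  have h6 := ad _ h5
  simp only [lie_smul, lie_add, h06, h07, smul_zero, add_zero] at h6
  have g1 := hX7 _ h6
  simp only [g1, zero_smul, zero_add] at h5 hg h1 h2 h3 h4
  have g2 := hX7 _ h5
  simp only [g2, zero_smul, zero_add, add_zero] at hg h1 h2 h3 h4
  have g3 := hX7 _ h4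
  simp only [g3, zero_smul, zero_add, add_zero] at hg h1 h2 h3
  have g4 := hX7 _ h3
  simp only [g4, zero_smul, zero_add, add_zero] at hg h1 h2
  have g5 := hX7 _ h2
  simp only [g5, zero_smul, zero_add, add_zero] at hg h1
  have g6 := hX7 _ h1
  simp only [g6, zero_smul, add_zero] at hg
  have h7 : ⁅g 0 • X 0 + g 7 • X 7, X 6⁆ = 0 := by rw [hg]; simp
  have h76 : ⁅X 7, X 6⁆ = 0 := by rw [← lie_skew, h67]; simp
  simp only [add_lie, smul_lie, h06, h76, smul_zero, add_zero] at h7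
  have g0 := hX7 _ h7
  simp only [g0, zero_smul, zero_add] at hg
  have g7 := hX7 _ hg
  intro i
  fin_cases i <;> assumption

/-- A family `X₀, …, X₇` with `[X₀, Xᵢ] = Xᵢ₊₁`, whose other brackets are controlled by six
structure constants. -/
structure IsFiliformChain (X : Fin 8 → L) (α β a₅ a₆ a₇ δ : ℝ) : Prop where
  lie01 : ⁅X 0, X 1⁆ = X 2
  lie02 : ⁅X 0, X 2⁆ = X 3
  lie03 : ⁅X 0, X 3⁆ = X 4
  lie04 : ⁅X 0, X 4⁆ = X 5
  lie05 : ⁅X 0, X 5⁆ = X 6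
  lie06 : ⁅X 0, X 6⁆ = X 7
  lie07 : ⁅X 0, X 7⁆ = 0
  lie12 : ⁅X 1, X 2⁆ = α • X 4 + a₅ • X 5 + a₆ • X 6 + a₇ • X 7
  lie23 : ⁅X 2, X 3⁆ = β • X 6 + δ • X 7
  lie34 : ⁅X 3, X 4⁆ = 0
  ne_zero : X 7 ≠ 0

namespace IsFiliformChain

variable {X : Fin 8 → L} {α β a₅ a₆ a₇ δ : ℝ}

/-- Since `ad (X 0)` is a derivation that raises indices by one, a bracket `[X i, X j]` follows from
brackets of smaller index sum. All remaining brackets of a chain are obtained in this way. -/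
theorem lie13 (h : IsFiliformChain X α β a₅ a₆ a₇ δ) :
    ⁅X 1, X 3⁆ = α • X 5 + a₅ • X 6 + a₆ • X 7 := by
  rw [← h.lie02, lie_lie_right, h.lie01, h.lie12]
  simp [h.lie04, h.lie05, h.lie06, h.lie07]

theorem lie14 (h : IsFiliformChain X α β a₅ a₆ a₇ δ) :
    ⁅X 1, X 4⁆ = (α - β) • X 6 + (a₅ - δ) • X 7 := by
  rw [← h.lie03, lie_lie_right, h.lie01, h.lie13, h.lie23]
  simp only [lie_add, lie_smul, h.lie05, h.lie06, h.lie07]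
  module

theorem lie24 (h : IsFiliformChain X α β a₅ a₆ a₇ δ) : ⁅X 2, X 4⁆ = β • X 7 := by
  rw [← h.lie03, lie_lie_right, h.lie02, h.lie23]
  simp [h.lie06, h.lie07]

theorem lie15 (h : IsFiliformChain X α β a₅ a₆ a₇ δ) :
    ⁅X 1, X 5⁆ = (α - 2 * β) • X 7 := by
  rw [← h.lie04, lie_lie_right, h.lie01, h.lie14, h.lie24]
  simp only [lie_add, lie_smul, h.lie06, h.lie07]
  module

theorem lie25 (h : IsFiliformChain X α β a₅ a₆ a₇ δ) : ⁅X 2, X 5⁆ = 0 := by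
  rw [← h.lie04, lie_lie_right, h.lie02, h.lie24, h.lie34]
  simp [h.lie07]

theorem lie16 (h : IsFiliformChain X α β a₅ a₆ a₇ δ) : ⁅X 1, X 6⁆ = 0 := by
  rw [← h.lie05, lie_lie_right, h.lie01, h.lie15, h.lie25]
  simp [h.lie07]

theorem lie35 (h : IsFiliformChain X α β a₅ a₆ a₇ δ) : ⁅X 3, X 5⁆ = 0 := by
  rw [← h.lie04, lie_lie_right, h.lie03, h.lie34]
  simp

theorem lie26 (h : IsFiliformChain X α β a₅ a₆ a₇ δ) : ⁅X 2, X 6⁆ = 0 := by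
  rw [← h.lie05, lie_lie_right, h.lie02, h.lie25, h.lie35]
  simp

theorem lie17 (h : IsFiliformChain X α β a₅ a₆ a₇ δ) : ⁅X 1, X 7⁆ = 0 := by
  rw [← h.lie06, lie_lie_right, h.lie01, h.lie16, h.lie26]
  simp

theorem lie27 (h : IsFiliformChain X α β a₅ a₆ a₇ δ) : ⁅X 2, X 7⁆ = 0 := by
  rw [← h.lie01, lie_lie, h.lie17, h.lie07]
  simp

theorem lie36 (h : IsFiliformChain X α β a₅ a₆ a₇ δ) : ⁅X 3, X 6⁆ = 0 := by
  rw [← h.lie02, lie_lie, h.lie26, h.lie06, h.lie27]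
  simp

theorem lie37 (h : IsFiliformChain X α β a₅ a₆ a₇ δ) : ⁅X 3, X 7⁆ = 0 := by
  rw [← h.lie02, lie_lie, h.lie27, h.lie07]
  simp

theorem lie45 (h : IsFiliformChain X α β a₅ a₆ a₇ δ) : ⁅X 4, X 5⁆ = 0 := by
  rw [← h.lie03, lie_lie, h.lie35, h.lie05, h.lie36]
  simp

theorem lie46 (h : IsFiliformChain X α β a₅ a₆ a₇ δ) : ⁅X 4, X 6⁆ = 0 := by
  rw [← h.lie03, lie_lie, h.lie36, h.lie06, h.lie37]
  simp

theorem lie47 (h : IsFiliformChain X α β a₅ a₆ a₇ δ) : ⁅X 4, X 7⁆ = 0 := by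
  rw [← h.lie03, lie_lie, h.lie37, h.lie07]
  simp

theorem lie56 (h : IsFiliformChain X α β a₅ a₆ a₇ δ) : ⁅X 5, X 6⁆ = 0 := by
  rw [← h.lie04, lie_lie, h.lie46, h.lie06, h.lie47]
  simp

theorem lie57 (h : IsFiliformChain X α β a₅ a₆ a₇ δ) : ⁅X 5, X 7⁆ = 0 := by
  rw [← h.lie04, lie_lie, h.lie47, h.lie07]
  simp

theorem lie67 (h : IsFiliformChain X α β a₅ a₆ a₇ δ) : ⁅X 6, X 7⁆ = 0 := by
  rw [← h.lie05, lie_lie, h.lie57, h.lie07]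
  simp

theorem linearIndependent (h : IsFiliformChain X α β a₅ a₆ a₇ δ) : LinearIndependent ℝ X :=
  linearIndependent_of_lie h.lie01 h.lie02 h.lie03 h.lie04 h.lie05 h.lie06 h.lie07 h.lie67
    h.ne_zero

/-- The basis given by a chain of an eight-dimensional Lie algebra. -/
def basis (h : IsFiliformChain X α β a₅ a₆ a₇ δ) (hL : Module.finrank ℝ L = 8) :
    Module.Basis (Fin 8) ℝ L :=
  basisOfLinearIndependentOfCardEqFinrank h.linearIndependent (by simp [hL])

theorem coe_basis (h : IsFiliformChain X α β a₅ a₆ a₇ δ) (hL : Module.finrank ℝ L = 8) :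
    ⇑(h.basis hL) = X :=
  coe_basisOfLinearIndependentOfCardEqFinrank _ _

/-- The six structure constants of a chain determine the eight-dimensional Lie algebra. -/
theorem nonempty_lieEquiv {L' : Type*} [LieRing L'] [LieAlgebra ℝ L'] {X' : Fin 8 → L'}
    (h : IsFiliformChain X α β a₅ a₆ a₇ δ) (h' : IsFiliformChain X' α β a₅ a₆ a₇ δ)
    (hL : Module.finrank ℝ L = 8) (hL' : Module.finrank ℝ L' = 8) :
    Nonempty (L ≃ₗ⁅ℝ⁆ L') := by
  let f : L ≃ₗ[ℝ] L' := (h.basis hL).equiv (h'.basis hL') (Equiv.refl _)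
  have hf : ∀ i, f (X i) = X' i := by
    intro i
    have := (h.basis hL).equiv_apply i (h'.basis hL') (Equiv.refl _)
    simpa only [coe_basis, Equiv.refl_apply] using this
  have hlt : ∀ i j : Fin 8, i < j → f ⁅X i, X j⁆ = ⁅X' i, X' j⁆ := by
    intro i j hij
    fin_cases i <;> fin_cases j <;> first
      | exact absurd hij (by decide)
      | simp [hf, h.lie01, h.lie02, h.lie03, h.lie04, h.lie05, h.lie06, h.lie07, h.lie12, h.lie13,
          h.lie14, h.lie15, h.lie16, h.lie17, h.lie23, h.lie24, h.lie25, h.lie26, h.lie27,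
          h.lie34, h.lie35, h.lie36, h.lie37, h.lie45, h.lie46, h.lie47, h.lie56, h.lie57,
          h.lie67, h'.lie01, h'.lie02, h'.lie03, h'.lie04, h'.lie05, h'.lie06, h'.lie07, h'.lie12,
          h'.lie13, h'.lie14, h'.lie15, h'.lie16, h'.lie17, h'.lie23, h'.lie24, h'.lie25,
          h'.lie26, h'.lie27, h'.lie34, h'.lie35, h'.lie36, h'.lie37, h'.lie45, h'.lie46,
          h'.lie47, h'.lie56, h'.lie57, h'.lie67]
  have hij : ∀ i j : Fin 8, f ⁅X i, X j⁆ = ⁅X' i, X' j⁆ := by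
    intro i j
    rcases lt_trichotomy i j with hl | rfl | hl
    · exact hlt i j hl
    · simp
    · rw [← lie_skew, map_neg, hlt j i hl, lie_skew]
  let B₁ : L →ₗ[ℝ] L →ₗ[ℝ] L' :=
    LinearMap.mk₂ ℝ (fun x y => f ⁅x, y⁆) (by simp) (by simp) (by simp) (by simp)
  let B₂ : L →ₗ[ℝ] L →ₗ[ℝ] L' :=
    LinearMap.mk₂ ℝ (fun x y => ⁅f x, f y⁆) (by simp) (by simp) (by simp) (by simp)
  have hB : B₁ = B₂ := by
    refine (h.basis hL).ext fun i => (h.basis hL).ext fun j => ?_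
    simp only [coe_basis]
    exact (hij i j).trans (by simp [B₂, hf])
  exact ⟨{ f with
    map_lie' := fun {x y} => LinearMap.congr_fun₂ hB x y }⟩

/-- The ratio α : β is invariant, while a₅ and δ carry one more factor `1 / p`. Hence the size of
(α, β) and that of a linear combination of a₅ and δ can be normalized independently, up to being
nonzero. -/
theorem scale (h : IsFiliformChain X α β a₅ a₆ a₇ δ) {p q : ℝ} (hp : p ≠ 0) (hq : q ≠ 0) :
    IsFiliformChain ![p • X 0, q • X 1, (p * q) • X 2, (p ^ 2 * q) • X 3, (p ^ 3 * q) • X 4,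
      (p ^ 4 * q) • X 5, (p ^ 5 * q) • X 6, (p ^ 6 * q) • X 7]
      (q / p ^ 2 * α) (q / p ^ 2 * β) (q / p ^ 3 * a₅) (q / p ^ 4 * a₆) (q / p ^ 5 * a₇)
      (q / p ^ 3 * δ) where
  lie01 := by simp [h.lie01, smul_smul, mul_comm]
  lie02 := by simp [h.lie02, smul_smul]; ring_nf
  lie03 := by simp [h.lie03, smul_smul]; ring_nf
  lie04 := by simp [h.lie04, smul_smul]; ring_nf
  lie05 := by simp [h.lie05, smul_smul]; ring_nf
  lie06 := by simp [h.lie06, smul_smul]; ring_nf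
  lie07 := by simp [h.lie07]
  lie12 := by
    simp [h.lie12, smul_smul]
    match_scalars <;> field_simp
  lie23 := by
    simp [h.lie23, smul_smul]
    match_scalars <;> field_simp
  lie34 := by simp [h.lie34]
  ne_zero := by simp [h.ne_zero, hp, hq]

/-- The generator `X 0` is replaced by `X 0 + t • X 1`. The new a₆ and a₇ need no tracking, because
free parameters of the target family absorb them. For α = 2β the combination 3a₅ - 8δ does not
change, which is why that ratio needs separate families. -/
theorem exists_shift (h : IsFiliformChain X α β a₅ a₆ a₇ δ) (t : ℝ) :
    ∃ (X' : Fin 8 → L) (a₆' a₇' : ℝ),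
      IsFiliformChain X' α β (a₅ - 2 * t * α ^ 2) a₆' a₇' (δ - 3 * t * β * (α - β)) := by
  -- `b` is the new a₆. It is named because it enters the new a₇ through the `X 7`-term of the new
  -- sixth vector; the vectors themselves are iterated brackets with `X 0 + t • X 1`.
  obtain ⟨b, hb⟩ : ∃ b, b = a₆ - α * (2 * t * a₅ + t ^ 2 * α * (α - β))
      - (a₅ - 2 * t * α ^ 2) * (t * (3 * α - β)) := ⟨_, rfl⟩
  refine ⟨![X 0 + t • X 1, X 1, X 2,
    X 3 + t • (α • X 4 + a₅ • X 5 + a₆ • X 6 + a₇ • X 7),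
    X 4 + (2 * t * α) • X 5 + (2 * t * a₅ + t ^ 2 * α * (α - β)) • X 6
      + (2 * t * a₆ + t ^ 2 * (α * (a₅ - δ) + a₅ * (α - 2 * β))) • X 7,
    X 5 + (t * (3 * α - β)) • X 6 + (t * (3 * a₅ - δ) + t ^ 2 * α * (3 * α - 5 * β)) • X 7,
    X 6 + (t * (4 * α - 3 * β)) • X 7, X 7], b,
    a₇ - α * (2 * t * a₆ + t ^ 2 * (α * (a₅ - δ) + a₅ * (α - 2 * β)))
      - (a₅ - 2 * t * α ^ 2) * (t * (3 * a₅ - δ) + t ^ 2 * α * (3 * α - 5 * β))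
      - b * (t * (4 * α - 3 * β)), ?_⟩
  constructor
  case ne_zero => simpa using h.ne_zero
  all_goals
    simp [h.lie01, h.lie02, h.lie03, h.lie04, h.lie05, h.lie06, h.lie07, h.lie12, h.lie13,
      h.lie14, h.lie15, h.lie16, h.lie17, h.lie23, h.lie24, h.lie25, h.lie26, h.lie27,
      h.lie34, h.lie35, h.lie36, h.lie37, h.lie45, h.lie46, h.lie47, h.lie56, h.lie57, h.lie67]
  case lie34 =>
    have skew : ∀ {u v : L}, ⁅u, v⁆ = 0 → ⁅v, u⁆ = 0 := fun {u v} huv => by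
      rw [← lie_skew, huv, neg_zero]
    simp [skew h.lie45, skew h.lie46, skew h.lie47, skew h.lie56, skew h.lie57, skew h.lie67]
  all_goals
    try subst hb
    module

end IsFiliformChain
end Chain

/-! ### Lower central series of a filiform algebra. -/

theorem Submodule.exists_sub_smul_mem {V : Type*} [AddCommGroup V] [Module ℝ V]
    [FiniteDimensional ℝ V] {A B : Submodule ℝ V} (hBA : B ≤ A)
    (hd : Module.finrank ℝ A = Module.finrank ℝ B + 1) {u z : V} (hu : u ∈ A) (huB : u ∉ B)
    (hz : z ∈ A) : ∃ c : ℝ, z - c • u ∈ B := by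
  have hle : B ⊔ Submodule.span ℝ {u} ≤ A :=
    sup_le hBA ((Submodule.span_singleton_le_iff_mem _ _).mpr hu)
  have hlt : B < B ⊔ Submodule.span ℝ {u} := by
    refine lt_of_le_of_ne le_sup_left fun h => huB ?_
    rw [h]
    exact Submodule.mem_sup_right (Submodule.mem_span_singleton_self u)
  have heq : B ⊔ Submodule.span ℝ {u} = A :=
    Submodule.eq_of_le_of_finrank_le hle (by
      have := Submodule.finrank_lt_finrank_of_lt hlt
      omega)
  rw [← heq, Submodule.mem_sup] at hz
  obtain ⟨v, hv, s, hs, rfl⟩ := hz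
  obtain ⟨c, rfl⟩ := Submodule.mem_span_singleton.mp hs
  exact ⟨c, by simpa using hv⟩

section LowerCentralSeries

variable {L : Type*} [LieRing L] [LieAlgebra ℝ L]

local notation "𝒞" => LieModule.lowerCentralSeries ℝ L L

theorem lie_mem_lowerCentralSeries_succ (x : L) {z : L} {k : ℕ} (hz : z ∈ 𝒞 k) :
    ⁅x, z⁆ ∈ 𝒞 (k + 1) := by
  rw [LieModule.lowerCentralSeries_succ]
  exact LieSubmodule.lie_mem_lie (LieSubmodule.mem_top x) hz

/-- Induction on `i` with the Jacobi identity. The extra 1 comes from numbering the series from `𝒞 0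
= L`. -/
theorem lie_mem_lowerCentralSeries {i j : ℕ} {x y : L} (hx : x ∈ 𝒞 i) (hy : y ∈ 𝒞 j) :
    ⁅x, y⁆ ∈ 𝒞 (i + j + 1) := by
  induction i generalizing j x y with
  | zero => simpa using lie_mem_lowerCentralSeries_succ x hy
  | succ i ih =>
    rw [LieModule.lowerCentralSeries_succ, ← LieSubmodule.mem_toSubmodule,
      LieSubmodule.lieIdeal_oper_eq_linear_span'] at hx
    induction hx using Submodule.span_induction with
    | mem x hx =>
      obtain ⟨a, -, c, hc, rfl⟩ := hx
      rw [lie_lie]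
      refine sub_mem ?_ ?_
      · have := lie_mem_lowerCentralSeries_succ a (ih hc hy)
        rwa [show i + 1 + j + 1 = i + j + 1 + 1 by ring]
      · have := ih hc (lie_mem_lowerCentralSeries_succ a hy)
        rwa [show i + 1 + j + 1 = i + (j + 1) + 1 by ring]
    | zero => simp
    | add u v _ _ hu hv => rw [add_lie]; exact add_mem hu hv
    | smul c u _ hu => rw [smul_lie]; exact (𝒞 _).smul_mem c hu

/-- Once two consecutive terms agree the series is constant, so it could not reach zero later. -/
theorem lowerCentralSeries_lt {m : ℕ} (hm : 𝒞 (m + 1) = ⊥) (hm' : 𝒞 m ≠ ⊥) {k : ℕ}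
    (hk : k ≤ m) : 𝒞 (k + 1) < 𝒞 k := by
  refine lt_of_le_of_ne (LieModule.antitone_lowerCentralSeries ℝ L L k.le_succ) fun h => ?_
  have hc : ∀ j, 𝒞 (k + j) = 𝒞 k := by
    intro j
    induction j with
    | zero => rfl
    | succ j ih =>
      rw [← add_assoc, LieModule.lowerCentralSeries_succ, ih,
        ← LieModule.lowerCentralSeries_succ, h]
  have h1 := hc (m + 1 - k)
  rw [show k + (m + 1 - k) = m + 1 by omega, hm] at h1
  exact hm' (eq_bot_iff.mpr (h1 ▸ LieModule.antitone_lowerCentralSeries ℝ L L hk))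

theorem IsFiliform.lowerCentralSeries_seven (hL : IsFiliform L) (hd : Module.finrank ℝ L = 8) :
    𝒞 7 = ⊥ ∧ 𝒞 6 ≠ ⊥ := by
  have h := hL.2
  rw [hd] at h
  exact (LieModule.nilpotencyLength_eq_succ_iff ℝ L L 6).mp (by omega)

/-- Seven strict drops lead from 8 to 0, so exactly one drop is by two. It is the first: if `𝒞 1`
had codimension one, then `L = ℝx + 𝒞 1`, and `[x, x] = 0` would give `𝒞 1 ≤ 𝒞 2`. -/
theorem IsFiliform.finrank_lowerCentralSeries (hL : IsFiliform L)
    (hd : Module.finrank ℝ L = 8) {k : ℕ} (hk : 1 ≤ k) (hk7 : k ≤ 7) :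
    Module.finrank ℝ (𝒞 k).toSubmodule = 7 - k := by
  have : FiniteDimensional ℝ L := Module.finite_of_finrank_pos (by omega)
  obtain ⟨h7, h6⟩ := hL.lowerCentralSeries_seven hd
  have hlt : ∀ k, k ≤ 6 → Module.finrank ℝ (𝒞 (k + 1)).toSubmodule
      < Module.finrank ℝ (𝒞 k).toSubmodule := fun k hk =>
    Submodule.finrank_lt_finrank_of_lt (lowerCentralSeries_lt h7 h6 hk)
  have hd0 : Module.finrank ℝ (𝒞 0).toSubmodule = 8 := by
    rw [LieModule.lowerCentralSeries_zero, LieSubmodule.top_toSubmodule, finrank_top, hd]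
  have hd1 : Module.finrank ℝ (𝒞 1).toSubmodule ≠ 7 := by
    intro h1
    have hlt0 := lowerCentralSeries_lt h7 h6 (Nat.zero_le 6)
    obtain ⟨x, -, hx⟩ := SetLike.exists_of_lt hlt0
    have hex : ∀ z : L, ∃ c : ℝ, z - c • x ∈ 𝒞 1 := fun z =>
      Submodule.exists_sub_smul_mem (A := (𝒞 0).toSubmodule) (B := (𝒞 1).toSubmodule) hlt0.le
        (by omega) (LieSubmodule.mem_top x) hx (LieSubmodule.mem_top z)
    refine (lowerCentralSeries_lt h7 h6 (show 1 ≤ 6 by norm_num)).not_ge ?_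
    conv_lhs => rw [LieModule.lowerCentralSeries_succ]
    rw [LieSubmodule.lie_le_iff]
    intro z _ v _
    obtain ⟨c, hz⟩ := hex z
    obtain ⟨c', hv⟩ := hex v
    have hzx : ⁅z - c • x, x⁆ ∈ 𝒞 2 := by
      rw [← lie_skew]
      exact neg_mem (lie_mem_lowerCentralSeries_succ x hz)
    have heq : ⁅z, v⁆ = ⁅z, v - c' • x⁆ + c' • ⁅z - c • x, x⁆ := by simp
    rw [heq]
    exact add_mem (lie_mem_lowerCentralSeries_succ z hv) ((𝒞 2).smul_mem c' hzx)
  obtain ⟨d, hdef⟩ : ∃ d : ℕ → ℕ, ∀ k, Module.finrank ℝ (𝒞 k).toSubmodule = d k :=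
    ⟨_, fun _ => rfl⟩
  simp only [hdef] at hlt hd0 hd1 ⊢
  have e0 : d 1 < d 0 := hlt 0 (by norm_num)
  have e1 : d 2 < d 1 := hlt 1 (by norm_num)
  have e2 : d 3 < d 2 := hlt 2 (by norm_num)
  have e3 : d 4 < d 3 := hlt 3 (by norm_num)
  have e4 : d 5 < d 4 := hlt 4 (by norm_num)
  have e5 : d 6 < d 5 := hlt 5 (by norm_num)
  have e6 : d 7 < d 6 := hlt 6 (by norm_num)
  interval_cases k <;> omega

/-- A generic vector of a filiform Lie algebra acts without zeros on the graded pieces of the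
lower central series. -/
theorem exists_lie_notMem_lowerCentralSeries {m : ℕ} (hm : 𝒞 (m + 1) = ⊥) (hm' : 𝒞 m ≠ ⊥) :
    ∃ x : L, ∀ k < m, ∃ z ∈ 𝒞 k, ⁅x, z⁆ ∉ 𝒞 (k + 2) := by
  let H : ℕ → Submodule ℝ L := fun k =>
    { carrier := {x | ∀ z ∈ 𝒞 k, ⁅x, z⁆ ∈ 𝒞 (k + 2)}
      add_mem' := fun {a b} ha hb z hz => by rw [add_lie]; exact add_mem (ha z hz) (hb z hz)
      zero_mem' := fun z _ => by rw [zero_lie]; exact zero_mem _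
      smul_mem' := fun c a ha z hz => by
        rw [smul_lie]
        exact (𝒞 (k + 2)).smul_mem c (ha z hz) }
  have hH : ∀ k < m, H k ≠ ⊤ := by
    intro k hk h
    refine (lowerCentralSeries_lt hm hm' (show k + 1 ≤ m by omega)).not_ge ?_
    conv_lhs => rw [LieModule.lowerCentralSeries_succ]
    rw [LieSubmodule.lie_le_iff]
    intro x _ z hz
    have hx : x ∈ H k := h ▸ Submodule.mem_top
    exact hx z hz
  by_contra! hcon
  -- A real vector space is not a finite union of proper subspaces.
  obtain ⟨i, hi⟩ := Subspace.exists_eq_top_of_iUnion_eq_univ (p := fun i : Fin m => H i) (by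
    refine Set.eq_univ_of_forall fun x => ?_
    obtain ⟨k, hk, hx⟩ := hcon x
    exact Set.mem_iUnion.mpr ⟨⟨k, hk⟩, hx⟩)
  exact hH i i.2 hi

/-- Coordinates with respect to the graded pieces of the lower central series. -/
theorem IsFiliform.exists_sub_smul_mem (hL : IsFiliform L) (hd : Module.finrank ℝ L = 8) {k : ℕ}
    (hk : 1 ≤ k) (hk6 : k ≤ 6) {u z : L} (hu : u ∈ 𝒞 k) (hu' : u ∉ 𝒞 (k + 1)) (hz : z ∈ 𝒞 k) :
    ∃ c : ℝ, z - c • u ∈ 𝒞 (k + 1) := by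
  have : FiniteDimensional ℝ L := Module.finite_of_finrank_pos (by omega)
  refine Submodule.exists_sub_smul_mem (A := (𝒞 k).toSubmodule) (B := (𝒞 (k + 1)).toSubmodule)
    (LieModule.antitone_lowerCentralSeries ℝ L L k.le_succ) ?_ hu hu' hz
  rw [hL.finrank_lowerCentralSeries hd hk (by omega),
    hL.finrank_lowerCentralSeries hd (by omega) (by omega)]
  omega

/-- A filiform Lie algebra of dimension eight contains a chain `Xᵢ₊₁ = [X₀, Xᵢ]` adapted to the
lower central series. -/
theorem IsFiliform.exists_chain (hL : IsFiliform L) (hd : Module.finrank ℝ L = 8) :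
    ∃ (X : Fin 8 → L) (α a₅ a₆ a₇ ε β δ γ : ℝ), ⁅X 0, X 1⁆ = X 2 ∧ ⁅X 0, X 2⁆ = X 3 ∧
      ⁅X 0, X 3⁆ = X 4 ∧ ⁅X 0, X 4⁆ = X 5 ∧ ⁅X 0, X 5⁆ = X 6 ∧ ⁅X 0, X 6⁆ = X 7 ∧
      ⁅X 1, X 2⁆ = α • X 4 + a₅ • X 5 + a₆ • X 6 + a₇ • X 7 ∧
      ⁅X 2, X 3⁆ = ε • X 5 + β • X 6 + δ • X 7 ∧ ⁅X 3, X 4⁆ = γ • X 7 ∧ X 7 ≠ 0 ∧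
      ∀ i : Fin 8, 1 ≤ i → X i ∈ 𝒞 ((i : ℕ) - 1) := by
  obtain ⟨h7, h6⟩ := hL.lowerCentralSeries_seven hd
  obtain ⟨x, hx⟩ := exists_lie_notMem_lowerCentralSeries h7 h6
  obtain ⟨y, -, hy⟩ := hx 0 (by norm_num)
  have step : ∀ k, 1 ≤ k → k < 6 → ∀ u ∈ 𝒞 k, u ∉ 𝒞 (k + 1) →
      ⁅x, u⁆ ∈ 𝒞 (k + 1) ∧ ⁅x, u⁆ ∉ 𝒞 (k + 2) := by
    intro k hk hk6 u hu hu'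
    refine ⟨lie_mem_lowerCentralSeries_succ x hu, fun hxu => ?_⟩
    obtain ⟨z, hz, hxz⟩ := hx k hk6
    obtain ⟨c, hc⟩ := hL.exists_sub_smul_mem hd hk hk6.le hu hu' hz
    apply hxz
    have heq : ⁅x, z⁆ = ⁅x, z - c • u⁆ + c • ⁅x, u⁆ := by simp
    rw [heq]
    exact add_mem (lie_mem_lowerCentralSeries_succ x hc) ((𝒞 (k + 2)).smul_mem c hxu)
  have m2 : ⁅x, y⁆ ∈ 𝒞 1 := lie_mem_lowerCentralSeries_succ x (k := 0) (LieSubmodule.mem_top y)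
  obtain ⟨X2, h01⟩ : ∃ u, u = ⁅x, y⁆ := ⟨_, rfl⟩
  rw [← h01] at m2 hy
  obtain ⟨m3, n3⟩ := step 1 (by norm_num) (by norm_num) _ m2 hy
  obtain ⟨X3, h02⟩ : ∃ u, u = ⁅x, X2⁆ := ⟨_, rfl⟩
  rw [← h02] at m3 n3
  obtain ⟨m4, n4⟩ := step 2 (by norm_num) (by norm_num) _ m3 n3
  obtain ⟨X4, h03⟩ : ∃ u, u = ⁅x, X3⁆ := ⟨_, rfl⟩
  rw [← h03] at m4 n4
  obtain ⟨m5, n5⟩ := step 3 (by norm_num) (by norm_num) _ m4 n4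
  obtain ⟨X5, h04⟩ : ∃ u, u = ⁅x, X4⁆ := ⟨_, rfl⟩
  rw [← h04] at m5 n5
  obtain ⟨m6, n6⟩ := step 4 (by norm_num) (by norm_num) _ m5 n5
  obtain ⟨X6, h05⟩ : ∃ u, u = ⁅x, X5⁆ := ⟨_, rfl⟩
  rw [← h05] at m6 n6
  obtain ⟨m7, n7⟩ := step 5 (by norm_num) (by norm_num) _ m6 n6
  obtain ⟨X7, h06⟩ : ∃ u, u = ⁅x, X6⁆ := ⟨_, rfl⟩
  rw [← h06] at m7 n7
  simp only [Nat.reduceAdd] at m2 m3 m4 m5 m6 m7 hy n3 n4 n5 n6 n7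
  have c6 : ∀ z ∈ 𝒞 6, ∃ c : ℝ, z = c • X7 := by
    intro z hz
    obtain ⟨c, hc⟩ := hL.exists_sub_smul_mem hd (by norm_num) le_rfl m7 n7 hz
    rw [h7, LieSubmodule.mem_bot, sub_eq_zero] at hc
    exact ⟨c, hc⟩
  have c5 : ∀ z ∈ 𝒞 5, ∃ b c : ℝ, z = b • X6 + c • X7 := by
    intro z hz
    obtain ⟨b, hb⟩ := hL.exists_sub_smul_mem hd (by norm_num) (by norm_num) m6 n6 hz
    obtain ⟨c, hc⟩ := c6 _ hb
    exact ⟨b, c, by rw [← hc]; abel⟩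
  have c4 : ∀ z ∈ 𝒞 4, ∃ a b c : ℝ, z = a • X5 + b • X6 + c • X7 := by
    intro z hz
    obtain ⟨a, ha⟩ := hL.exists_sub_smul_mem hd (by norm_num) (by norm_num) m5 n5 hz
    obtain ⟨b, c, hc⟩ := c5 _ ha
    exact ⟨a, b, c, by rw [add_assoc, ← hc]; abel⟩
  have c3 : ∀ z ∈ 𝒞 3, ∃ s a b c : ℝ, z = s • X4 + a • X5 + b • X6 + c • X7 := by
    intro z hz
    obtain ⟨s, hs⟩ := hL.exists_sub_smul_mem hd (by norm_num) (by norm_num) m4 n4 hz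
    obtain ⟨a, b, c, hc⟩ := c4 _ hs
    exact ⟨s, a, b, c, by rw [add_assoc, add_assoc, ← add_assoc (a • X5), ← hc]; abel⟩
  -- `r` is the `X3`-component of `[y, X2]`. Passing from `y` to `y - r • x` removes it without
  -- changing `[x, y]`.
  obtain ⟨r, hr⟩ := hL.exists_sub_smul_mem hd (k := 2) (by norm_num) (by norm_num) m3 n3
    (lie_mem_lowerCentralSeries_succ y m2)
  obtain ⟨α, a₅, a₆, a₇, h12⟩ := c3 _ hr
  obtain ⟨ε, β, δ, h23⟩ := c4 _ (lie_mem_lowerCentralSeries m2 m3)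
  obtain ⟨γ, h34⟩ := c6 _ (lie_mem_lowerCentralSeries m3 m4)
  refine ⟨![x, y - r • x, X2, X3, X4, X5, X6, X7], α, a₅, a₆, a₇, ε, β, δ, γ, ?_, h02.symm,
    h03.symm, h04.symm, h05.symm, h06.symm, ?_, h23, h34, ?_, ?_⟩
  · simp [h01]
  · simpa [← h02] using h12
  · rintro rfl
    exact n7 (zero_mem _)
  · intro i hi
    fin_cases i
    · exact absurd hi (by decide)
    · exact LieSubmodule.mem_top _
    exacts [m2, m3, m4, m5, m6, m7]

end LowerCentralSeries

/-! ### Constraints imposed by the symplectic form. -/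

section SymplecticChain

variable {L : Type*} [LieRing L] [LieAlgebra ℝ L] {w : LinearMap.BilinForm ℝ L}

theorem IsSymplecticForm.neg_apply (hw : IsSymplecticForm w) (x y : L) : w y x = -w x y :=
  (hw.isAlt.neg_eq x y).symm

theorem IsSymplecticForm.apply_lie (hw : IsSymplecticForm w) (x y z : L) :
    w x ⁅y, z⁆ = w y ⁅x, z⁆ + w ⁅x, y⁆ z := by
  have h := hw.closed x y z
  rw [← lie_skew z x, map_neg, hw.neg_apply ⁅x, y⁆ z] at h
  linarith

theorem IsSymplecticForm.eq_zero_of_apply_basis (hw : IsSymplecticForm w) {ι : Type*}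
    (b : Module.Basis ι ℝ L) {z : L} (h : ∀ i, w z (b i) = 0) : z = 0 :=
  hw.nondegenerate.1 z fun y => by
    have : w z = 0 := b.ext h
    rw [this, LinearMap.zero_apply]

theorem IsSymplecticForm.eq_zero_of_apply_eq_zero (hw : IsSymplecticForm w)
    (hd : Module.finrank ℝ L = 8) {X : Fin 8 → L} (hX : LinearIndependent ℝ X) {z : L}
    (h0 : w z (X 0) = 0) (h1 : w z (X 1) = 0) (h2 : w z (X 2) = 0) (h3 : w z (X 3) = 0)
    (h4 : w z (X 4) = 0) (h5 : w z (X 5) = 0) (h6 : w z (X 6) = 0) (h7 : w z (X 7) = 0) :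
    z = 0 := by
  refine hw.eq_zero_of_apply_basis
    (basisOfLinearIndependentOfCardEqFinrank hX (by simp [hd])) fun i => ?_
  rw [coe_basisOfLinearIndependentOfCardEqFinrank]
  fin_cases i <;> assumption

/-- Closedness on `X 0`, `X i`, `X j` expresses `w (X 0) [X i, X j]` as the sum of the neighbouring
entries `(i, j + 1)` and `(i + 1, j)` of one antidiagonal. Each antidiagonal is then solved starting
from a vanishing entry; for `i + j = 8` this is `w (X 4) (X 4) = 0`. -/
theorem IsSymplecticForm.apply_eq_of_lie (hw : IsSymplecticForm w) {X : Fin 8 → L} {γ : ℝ}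
    (h01 : ⁅X 0, X 1⁆ = X 2) (h02 : ⁅X 0, X 2⁆ = X 3) (h03 : ⁅X 0, X 3⁆ = X 4)
    (h04 : ⁅X 0, X 4⁆ = X 5) (h05 : ⁅X 0, X 5⁆ = X 6) (h06 : ⁅X 0, X 6⁆ = X 7)
    (h07 : ⁅X 0, X 7⁆ = 0) (h16 : ⁅X 1, X 6⁆ = γ • X 7) (h17 : ⁅X 1, X 7⁆ = 0)
    (h25 : ⁅X 2, X 5⁆ = -γ • X 7) (h26 : ⁅X 2, X 6⁆ = 0) (h27 : ⁅X 2, X 7⁆ = 0)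
    (h34 : ⁅X 3, X 4⁆ = γ • X 7) (h35 : ⁅X 3, X 5⁆ = 0)
    (h36 : ⁅X 3, X 6⁆ = 0) (h37 : ⁅X 3, X 7⁆ = 0) (h46 : ⁅X 4, X 6⁆ = 0)
    (h47 : ⁅X 4, X 7⁆ = 0) (h57 : ⁅X 5, X 7⁆ = 0) :
    w (X 2) (X 7) = 0 ∧ w (X 3) (X 7) = 0 ∧ w (X 4) (X 7) = 0 ∧ w (X 5) (X 7) = 0 ∧
      w (X 6) (X 7) = 0 ∧ w (X 3) (X 6) = 0 ∧ w (X 4) (X 6) = 0 ∧ w (X 5) (X 6) = 0 ∧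
      w (X 4) (X 5) = 0 ∧ w (X 3) (X 5) = γ * w (X 0) (X 7) ∧
      w (X 2) (X 6) = -2 * γ * w (X 0) (X 7) ∧ w (X 1) (X 7) = 3 * γ * w (X 0) (X 7) := by
  have c := fun i j => hw.apply_lie (X 0) (X i) (X j)
  have hs : ∀ i, w (X i) (X i) = 0 := fun i => hw.isAlt (X i)
  have c57 := c 5 7
  have c47 := c 4 7
  have c37 := c 3 7
  have c27 := c 2 7
  have c17 := c 1 7
  have c46 := c 4 6
  have c36 := c 3 6
  have c26 := c 2 6
  have c16 := c 1 6
  have c35 := c 3 5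
  have c25 := c 2 5
  have c34 := c 3 4
  rw [h57, h05, h07, map_zero, map_zero] at c57
  rw [h47, h04, h07, map_zero, map_zero] at c47
  rw [h37, h03, h07, map_zero, map_zero] at c37
  rw [h27, h02, h07, map_zero, map_zero] at c27
  rw [h17, h01, h07, map_zero, map_zero] at c17
  rw [h46, h06, h04, map_zero] at c46
  rw [h36, h06, h03, map_zero] at c36
  rw [h26, h06, h02, map_zero] at c26
  rw [h16, h06, h01, map_smul, smul_eq_mul] at c16
  rw [h35, h05, h03, map_zero] at c35
  rw [h25, h05, h02, map_smul, smul_eq_mul] at c25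
  rw [h34, h04, h03, map_smul, smul_eq_mul, hs] at c34
  refine ⟨?_, ?_, ?_, ?_, ?_, ?_, ?_, ?_, ?_, ?_, ?_, ?_⟩ <;> linarith

/-- A symplectic filiform Lie algebra of dimension eight has a chain of the graded type of the
model filiform algebra. -/
theorem IsFiliform.exists_isFiliformChain (hL : IsFiliform L) (hd : Module.finrank ℝ L = 8)
    (hw : IsSymplecticForm w) :
    ∃ (X : Fin 8 → L) (α β a₅ a₆ a₇ δ : ℝ), IsFiliformChain X α β a₅ a₆ a₇ δ := by
  obtain ⟨X, α, a₅, a₆, a₇, ε, β, δ, γ, h01, h02, h03, h04, h05, h06, h12, h23, h34, hX7, hm⟩ :=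
    hL.exists_chain hd
  -- The bracket lies in the lower central term of index `i + j - 1`, which is zero from 7 on.
  have hz : ∀ i j : Fin 8, 1 ≤ i → 1 ≤ j → 8 ≤ (i : ℕ) + j → ⁅X i, X j⁆ = 0 := by
    intro i j hi hj hij
    have h := lie_mem_lowerCentralSeries (hm i hi) (hm j hj)
    have h' := LieModule.antitone_lowerCentralSeries ℝ L L
      (show 7 ≤ (i : ℕ) - 1 + (j - 1) + 1 by omega) h
    rwa [(hL.lowerCentralSeries_seven hd).1, LieSubmodule.mem_bot] at h'
  have h07 : ⁅X 0, X 7⁆ = 0 := by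
    have h := lie_mem_lowerCentralSeries_succ (X 0) (hm 7 (by decide))
    have h7 := (hL.lowerCentralSeries_seven hd).1
    rwa [show ((7 : Fin 8) : ℕ) - 1 + 1 = 7 from rfl, h7, LieSubmodule.mem_bot] at h
  have h17 := hz 1 7 (by decide) (by decide) (by decide)
  have h26 := hz 2 6 (by decide) (by decide) (by decide)
  have h27 := hz 2 7 (by decide) (by decide) (by decide)
  have h35 := hz 3 5 (by decide) (by decide) (by decide)
  have h36 := hz 3 6 (by decide) (by decide) (by decide)
  have h37 := hz 3 7 (by decide) (by decide) (by decide)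
  have h46 := hz 4 6 (by decide) (by decide) (by decide)
  have h47 := hz 4 7 (by decide) (by decide) (by decide)
  have h56 := hz 5 6 (by decide) (by decide) (by decide)
  have h57 := hz 5 7 (by decide) (by decide) (by decide)
  have h67 := hz 6 7 (by decide) (by decide) (by decide)
  have h53 := hz 5 3 (by decide) (by decide) (by decide)
  have h63 := hz 6 3 (by decide) (by decide) (by decide)
  have h73 := hz 7 3 (by decide) (by decide) (by decide)
  have hlin := linearIndependent_of_lie h01 h02 h03 h04 h05 h06 h07 h67 hX7
  have h13 : ⁅X 1, X 3⁆ = α • X 5 + a₅ • X 6 + a₆ • X 7 := by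
    rw [← h02, lie_lie_right, h01, h12]
    simp [h04, h05, h06, h07]
  have h14 : ⁅X 1, X 4⁆ = -ε • X 5 + (α - β) • X 6 + (a₅ - δ) • X 7 := by
    rw [← h03, lie_lie_right, h01, h13, h23]
    simp only [lie_add, lie_smul, h05, h06, h07]
    module
  have h24 : ⁅X 2, X 4⁆ = ε • X 6 + β • X 7 := by
    rw [← h03, lie_lie_right, h02, h23]
    simp [h05, h06, h07]
  have h15 : ⁅X 1, X 5⁆ = (-2 * ε) • X 6 + (α - 2 * β) • X 7 := by
    rw [← h04, lie_lie_right, h01, h14, h24]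
    simp only [lie_add, lie_smul, h05, h06, h07]
    module
  have h25 : ⁅X 2, X 5⁆ = (ε - γ) • X 7 := by
    rw [← h04, lie_lie_right, h02, h24, h34]
    simp only [lie_add, lie_smul, h06, h07]
    module
  have h16 : ⁅X 1, X 6⁆ = (-3 * ε + γ) • X 7 := by
    rw [← h05, lie_lie_right, h01, h15, h25]
    simp only [lie_add, lie_smul, h06, h07]
    module
  have h43 : ⁅X 4, X 3⁆ = -γ • X 7 := by rw [← lie_skew, h34, neg_smul]
  have hε : ε = 0 := by
    -- Applying `ad (X 0)` discards the `X 7`-terms of this Jacobi identity and leaves `-2ε² X 7 =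
    -- 0`.
    have h := congrArg (fun u => ⁅X 0, u⁆) (leibniz_lie (X 1) (X 2) (X 3))
    simp only [h12, h13, h23, h15, h16, h17, h25, h26, h27, h43, h53, h63, h73, lie_add, add_lie,
      lie_smul, smul_lie, h06, h07, smul_zero, add_zero, smul_smul] at h
    have h2 := (smul_eq_zero.mp h).resolve_right hX7
    nlinarith
  subst hε
  simp only [neg_zero, zero_smul, zero_add, mul_zero, zero_sub] at h14 h16 h25
  obtain ⟨w27, w37, w47, w57, w67, w36, w46, w56, w45, w35, w26, w17⟩ := hw.apply_eq_of_lie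
    h01 h02 h03 h04 h05 h06 h07 h16 h17 h25 h26 h27 h34 h35 h36 h37 h46 h47 h57
  have hγ : γ = 0 := by
    by_contra hγ
    -- This reads `3γ² w (X 0) (X 7) = 0`. For γ ≠ 0 the vector `X 7` would then lie in the radical
    -- of `w`.
    have d := hw.apply_lie (X 1) (X 3) (X 4)
    rw [h34, h14, h13] at d
    simp only [map_add, map_smul, smul_eq_mul, LinearMap.add_apply, LinearMap.smul_apply,
      hw.neg_apply (X 4) (X 5), hw.neg_apply (X 4) (X 6), hw.neg_apply (X 4) (X 7), w36, w37,
      w45, w46, w47, w17] at d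
    have hA : w (X 0) (X 7) = 0 := by
      have h3 : (3 * γ ^ 2) * w (X 0) (X 7) = 0 := by linarith
      exact (mul_eq_zero.mp h3).resolve_left (by positivity)
    rw [hA, mul_zero] at w17
    have neg := fun i => hw.neg_apply (X i) (X 7)
    exact hX7 (hw.eq_zero_of_apply_eq_zero hd hlin (by rw [neg, hA, neg_zero])
      (by rw [neg, w17, neg_zero]) (by rw [neg, w27, neg_zero]) (by rw [neg, w37, neg_zero])
      (by rw [neg, w47, neg_zero]) (by rw [neg, w57, neg_zero]) (by rw [neg, w67, neg_zero])
      (hw.isAlt (X 7)))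
  subst hγ
  refine ⟨X, α, β, a₅, a₆, a₇, δ, h01, h02, h03, h04, h05, h06, h07, h12, ?_, ?_, hX7⟩
  · simpa using h23
  · simpa using h34

/-- Write A, B, C, D for the antidiagonal entries of `w` at (0,7), (1,6), (2,5), (3,4). Closedness
gives B + C = (α - 2β)A, C + D = βA and βB = α(C - D), while A, B, C are nonzero by nondegeneracy.
Each excluded ratio would make one of them vanish. -/
theorem IsFiliformChain.eq_zero_or_ne_zero {X : Fin 8 → L} {α β a₅ a₆ a₇ δ : ℝ}
    (h : IsFiliformChain X α β a₅ a₆ a₇ δ) (hd : Module.finrank ℝ L = 8)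
    (hw : IsSymplecticForm w) :
    (α = 0 ∧ β = 0) ∨
      (α ≠ 0 ∧ β ≠ 0 ∧ α ≠ β ∧ β + 2 * α ≠ 0 ∧ 5 * β - 2 * α ≠ 0) := by
  have hlin := h.linearIndependent
  obtain ⟨w27, w37, w47, w57, w67, w36, w46, w56, w45, w35, w26, w17⟩ := hw.apply_eq_of_lie
    (γ := 0) h.lie01 h.lie02 h.lie03 h.lie04 h.lie05 h.lie06 h.lie07 (by simp [h.lie16]) h.lie17
    (by simp [h.lie25]) h.lie26 h.lie27 (by simp [h.lie34]) h.lie35 h.lie36 h.lie37 h.lie46 h.lie47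
    h.lie57
  simp only [mul_zero, zero_mul] at w35 w26 w17
  have c15 := hw.apply_lie (X 0) (X 1) (X 5)
  have c24 := hw.apply_lie (X 0) (X 2) (X 4)
  have d := hw.apply_lie (X 1) (X 2) (X 3)
  rw [h.lie15, h.lie05, h.lie01, map_smul, smul_eq_mul] at c15
  rw [h.lie24, h.lie04, h.lie02, map_smul, smul_eq_mul] at c24
  rw [h.lie23, h.lie13, h.lie12] at d
  have neg := fun i j => hw.neg_apply (X i) (X j)
  have hs : ∀ i, w (X i) (X i) = 0 := fun i => hw.isAlt (X i)
  simp only [map_add, map_smul, smul_eq_mul, LinearMap.add_apply, LinearMap.smul_apply,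
    neg 3 4, neg 3 5, neg 3 6, neg 3 7, w35, w36, w37, w26, w27, w17] at d
  have hA : w (X 0) (X 7) ≠ 0 := fun hA =>
    h.ne_zero (hw.eq_zero_of_apply_eq_zero hd hlin (by rw [neg, hA, neg_zero])
      (by rw [neg, w17, neg_zero]) (by rw [neg, w27, neg_zero]) (by rw [neg, w37, neg_zero])
      (by rw [neg, w47, neg_zero]) (by rw [neg, w57, neg_zero]) (by rw [neg, w67, neg_zero])
      (hs 7))
  have hX6 : ∀ v : ℝ, X 6 + v • X 7 ≠ 0 := fun v hv => by
    have := congrArg (fun u => ⁅X 0, u⁆) hv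
    simp [h.lie06, h.lie07, h.ne_zero] at this
  have hX5 : ∀ u v : ℝ, X 5 + u • X 6 + v • X 7 ≠ 0 := fun u v hv => by
    have := congrArg (fun u => ⁅X 0, u⁆) hv
    simp [h.lie05, h.lie06, h.lie07, hX6] at this
  have hB : w (X 1) (X 6) ≠ 0 := fun hB =>
    hX6 (-(w (X 0) (X 6) / w (X 0) (X 7))) (hw.eq_zero_of_apply_eq_zero hd hlin
      (by simp [neg 0 6, neg 0 7, hA]) (by simp [neg 1 6, neg 1 7, hB, w17])
      (by simp [neg 2 6, neg 2 7, w26, w27]) (by simp [neg 3 6, neg 3 7, w36, w37])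
      (by simp [neg 4 6, neg 4 7, w46, w47]) (by simp [neg 5 6, neg 5 7, w56, w57])
      (by simp [hs, neg 6 7, w67]) (by simp [hs, w67]))
  have hC : w (X 2) (X 5) ≠ 0 := by
    intro hC
    -- `u` and `v` make `X 5 + u • X 6 + v • X 7` orthogonal to `X 1` and `X 0`; with `hC` it is
    -- orthogonal to everything.
    obtain ⟨u, hu⟩ : ∃ u, u * w (X 1) (X 6) = -w (X 1) (X 5) :=
      ⟨-w (X 1) (X 5) / w (X 1) (X 6), by field_simp⟩
    obtain ⟨v, hv⟩ : ∃ v, v * w (X 0) (X 7) = -w (X 0) (X 5) - u * w (X 0) (X 6) :=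
      ⟨(-w (X 0) (X 5) - u * w (X 0) (X 6)) / w (X 0) (X 7), by field_simp⟩
    exact hX5 u v (hw.eq_zero_of_apply_eq_zero hd hlin
      (by simp [neg 0 5, neg 0 6, neg 0 7]; linarith)
      (by simp [neg 1 5, neg 1 6, neg 1 7, w17]; linarith)
      (by simp [neg 2 5, neg 2 6, neg 2 7, hC, w26, w27])
      (by simp [neg 3 5, neg 3 6, neg 3 7, w35, w36, w37])
      (by simp [neg 4 5, neg 4 6, neg 4 7, w45, w46, w47])
      (by simp [hs, neg 5 6, neg 5 7, w56, w57])
      (by simp [hs, w56, neg 6 7, w67]) (by simp [hs, w57, w67]))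
  generalize w (X 0) (X 7) = A at *
  generalize w (X 1) (X 6) = B at *
  generalize w (X 2) (X 5) = C at *
  generalize w (X 3) (X 4) = D at *
  have hD : D = A * β - C := by linarith
  have hB' : B = A * (α - 2 * β) - C := by linarith
  have key : 2 * A * β * (α - β) = C * (β + 2 * α) := by
    subst hD hB'
    linarith
  by_cases hβ : β = 0
  · left
    subst hβ
    refine ⟨?_, rfl⟩
    have : C * α = 0 := by linarith
    exact (mul_eq_zero.mp this).resolve_left hC
  right
  refine ⟨?_, hβ, ?_, ?_, ?_⟩
  · rintro rfl
    have h1 : β * (C + 2 * A * β) = 0 := by linarith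
    have h2 := (mul_eq_zero.mp h1).resolve_left hβ
    exact hB (by linarith)
  · rintro rfl
    have h1 : C * α = 0 := by linarith
    exact (mul_ne_zero hC hβ) h1
  · intro h0
    obtain rfl : β = -2 * α := by linarith
    have h1 : A * ((-2 * α) * (-2 * α)) = 0 := by linarith
    exact mul_ne_zero hA (mul_ne_zero hβ hβ) h1
  · intro h0
    obtain rfl : α = 5 / 2 * β := by linarith
    have h1 : β * (A * β - 2 * C) = 0 := by linarith
    have h2 := (mul_eq_zero.mp h1).resolve_left hβ
    exact hB (by linarith)

end SymplecticChain

/-! ### Chains in the algebras of the list. -/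

theorem Entry.finrank_algebra (R : Entry) : Module.finrank ℝ R.Algebra = 8 :=
  (Module.finrank_fin_fun ℝ : Module.finrank ℝ (Fin 8 → ℝ) = 8)

theorem Entry.isFiliformChain_of_bracket (R : Entry) {X : Fin 8 → Fin 8 → ℝ}
    {α β a₅ a₆ a₇ δ : ℝ} (h01 : R.bracket (X 0) (X 1) = X 2) (h02 : R.bracket (X 0) (X 2) = X 3)
    (h03 : R.bracket (X 0) (X 3) = X 4) (h04 : R.bracket (X 0) (X 4) = X 5)
    (h05 : R.bracket (X 0) (X 5) = X 6) (h06 : R.bracket (X 0) (X 6) = X 7)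
    (h07 : R.bracket (X 0) (X 7) = 0)
    (h12 : R.bracket (X 1) (X 2) = α • X 4 + a₅ • X 5 + a₆ • X 6 + a₇ • X 7)
    (h23 : R.bracket (X 2) (X 3) = β • X 6 + δ • X 7)
    (h34 : R.bracket (X 3) (X 4) = 0) (h7 : X 7 ≠ 0) :
    IsFiliformChain (L := R.Algebra) X α β a₅ a₆ a₇ δ :=
  ⟨h01, h02, h03, h04, h05, h06, h07, h12, h23, h34, h7⟩

theorem Entry.bracket_g80 {a b c d l μ μ₁ ν : ℝ} (hν : ν * (μ - 1) = μ₁ - μ)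
    (hrel : 2 * μ * (ν + 1) = ν * (3 * ν + 5)) (hμ : μ ≠ 0)
    (hb : b * (ν + 1) * (μ + 1) ≠ 0) (x y : Fin 8 → ℝ) :
    (Entry.g80 a b c d l μ μ₁ ν hν hrel hμ hb).bracket x y = ![
        ee 1 2 x y * c + ee 1 3 x y * d - ee 2 3 x y * ((μ + 1) * a) - ee 1 6 x y * μ
          - ee 2 7 x y * ν - ee 4 5 x y,
        0, - ee 1 4 x y, - ee 2 4 x y, 0,
        ee 1 2 x y * (ν * l - d) + ee 1 3 x y * ((μ + 1) * a) - ee 2 3 x y * (ν * (ν + 2) * b)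
          - ee 1 7 x y * μ₁ - ee 4 6 x y * (μ + 1),
        ee 1 2 x y * ((μ₁ - 1) * a) - ee 1 3 x y * (ν * (ν + 1) * b) - ee 4 7 x y * (ν + 1),
        ee 1 2 x y * (ν * b) + ee 1 4 x y * l - ee 2 4 x y * ((μ + 1) * a)
          + ee 3 4 x y * ((ν + 2) * b)] := by
  ext k
  fin_cases k <;> simp [Entry.bracket, e] <;> ring

theorem Entry.bracket_g90 {a b c d l : ℝ} (hl : l ≠ 0) (x y : Fin 8 → ℝ) :
    (Entry.g90 a b c d l hl).bracket x y = ![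
        -(ee 1 2 x y * c) + ee 1 3 x y * a + ee 2 3 x y * b - ee 4 5 x y,
        0, - ee 1 4 x y, - ee 2 4 x y, 0,
        -(ee 1 2 x y * a) - ee 1 3 x y * b - ee 4 6 x y,
        ee 1 2 x y * b - ee 4 7 x y,
        ee 1 4 x y * d + ee 2 4 x y * b + ee 3 4 x y * l] := by
  ext k
  fin_cases k <;> simp [Entry.bracket, e] <;> ring

theorem Entry.bracket_g91 {a b c d l : ℝ} (hbd : b - d ≠ 0) (x y : Fin 8 → ℝ) :
    (Entry.g91 a b c d l hbd).bracket x y = ![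
        ee 2 3 x y * d - ee 1 7 x y - ee 4 5 x y,
        0, - ee 1 4 x y, - ee 2 4 x y, 0,
        ee 1 2 x y * a - ee 1 3 x y * b + ee 3 4 x y * c - ee 4 6 x y - ee 4 7 x y,
        ee 1 2 x y * b - ee 3 4 x y * (a + d) - ee 4 7 x y,
        ee 1 4 x y * l - ee 2 4 x y * a + ee 3 4 x y * (b - d)] := by
  ext k
  fin_cases k <;> simp [Entry.bracket, e] <;> ring

theorem Entry.bracket_g93 {a b c d l : ℝ} (hb : b ≠ 0) (x y : Fin 8 → ℝ) :
    (Entry.g93 a b c d l hb).bracket x y = ![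
        -(ee 1 3 x y * c) + ee 3 4 x y * l + ee 2 7 x y * (5 / 3) - ee 4 5 x y,
        0, - ee 1 4 x y, - ee 2 4 x y, 0,
        ee 2 3 x y * (1 / 3 * b) - ee 3 4 x y * d - ee 1 7 x y * (5 / 3) - ee 4 6 x y,
        -(ee 1 2 x y * a) - ee 1 3 x y * (2 / 3 * b) + ee 3 4 x y * (3 / 5 * a)
          + ee 4 7 x y * (2 / 3),
        -(ee 1 2 x y * b) + ee 1 4 x y * (3 / 5 * c) + ee 2 4 x y * (3 / 5 * a)
          + ee 3 4 x y * (1 / 5 * b)] := by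
  ext k
  fin_cases k <;> simp [Entry.bracket, e] <;> ring

theorem Entry.bracket_g95 {a b c d l : ℝ} (hb : b ≠ 0) (x y : Fin 8 → ℝ) :
    (Entry.g95 a b c d l hb).bracket x y = ![
        -(ee 1 3 x y * c) + ee 2 3 x y * (1 / 3 * b) + ee 3 4 x y * l + ee 1 7 x y * (5 / 3)
          + ee 2 7 x y * (5 / 3) - ee 4 5 x y,
        0, - ee 1 4 x y, - ee 2 4 x y, 0,
        ee 2 3 x y * (1 / 3 * b) - ee 3 4 x y * d - ee 1 7 x y * (5 / 3) - ee 4 6 x y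
          + ee 4 7 x y * (5 / 3),
        -(ee 1 2 x y * a) - ee 1 3 x y * (2 / 3 * b) + ee 3 4 x y * (3 / 5 * a - 4 / 3 * b)
          + ee 4 7 x y * (2 / 3),
        -(ee 1 2 x y * b) + ee 1 4 x y * (3 / 5 * a - b + 3 / 5 * c)
          + ee 2 4 x y * (3 / 5 * a - b) + ee 3 4 x y * (1 / 5 * b)] := by
  ext k
  fin_cases k <;> simp [Entry.bracket, e] <;> ring

/-- The generators are `e 4` and `e 1`, here and for the other families, and the listed vectors are
their iterated brackets, with the `e 8`-coordinate in position 0. Comparing coordinates in `[X 1, X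
2]` gives `h₄` to `h₇`, and in `[X 2, X 3]` gives `hβ` and `hδ`. -/
theorem Entry.exists_isFiliformChain_g80 {a b c d l μ μ₁ ν : ℝ} (hν : ν * (μ - 1) = μ₁ - μ)
    (hrel : 2 * μ * (ν + 1) = ν * (3 * ν + 5)) (hμ : μ ≠ 0)
    (hb : b * (ν + 1) * (μ + 1) ≠ 0) (hν₂ : ν + 2 ≠ 0) {α β a₅ a₆ a₇ δ : ℝ}
    (h₄ : ν * b = -(α * (ν + 2) * b))
    (h₅ : (μ₁ - 1) * a = -(α * (ν + 1) * (μ + 1) * a) + a₅ * (ν + 2) * (ν + 1) * b)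
    (h₆ : ν * l - d + l * μ₁ = -(α * l * (ν + 1) * (μ + 1)) + a₅ * (ν + 1) * (μ + 1) ^ 2 * a
      - a₆ * (ν + 2) * (ν + 1) * (μ + 1) * b)
    (h₇ : c = a₅ * l * (ν + 1) * (μ + 1) - a₆ * (ν + 1) * (μ + 1) ^ 2 * a
      + a₇ * (ν + 2) * (ν + 1) * (μ + 1) * b)
    (hβ : ν * (ν + 2) * b = β * (ν + 2) * (ν + 1) * (μ + 1) * b)
    (hδ : -((ν + 1) * (μ + 1) * a) = -(β * (ν + 1) * (μ + 1) ^ 2 * a)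
      + δ * (ν + 2) * (ν + 1) * (μ + 1) * b) :
    ∃ X, IsFiliformChain (L := (Entry.g80 a b c d l μ μ₁ ν hν hrel hμ hb).Algebra) X
      α β a₅ a₆ a₇ δ := by
  refine ⟨_, Entry.isFiliformChain_of_bracket _ (X := ![
    ![0, 0, 0, 0, 1, 0, 0, 0], ![0, 1, 0, 0, 0, 0, 0, 0], ![0, 0, 1, 0, 0, 0, 0, -l],
    ![0, 0, 0, 1, 0, 0, l * (ν + 1), (μ + 1) * a],
    ![0, 0, 0, 0, 0, -(l * (ν + 1) * (μ + 1)), -((ν + 1) * (μ + 1) * a), -((ν + 2) * b)],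
    ![l * (ν + 1) * (μ + 1), 0, 0, 0, 0, (ν + 1) * (μ + 1) ^ 2 * a, (ν + 2) * (ν + 1) * b, 0],
    ![-((ν + 1) * (μ + 1) ^ 2 * a), 0, 0, 0, 0, -((ν + 2) * (ν + 1) * (μ + 1) * b), 0, 0],
    ![(ν + 2) * (ν + 1) * (μ + 1) * b, 0, 0, 0, 0, 0, 0, 0]]) ?_ ?_ ?_ ?_ ?_ ?_ ?_ ?_ ?_ ?_ ?_⟩
  case refine_11 =>
    intro h
    have h0 : (ν + 2) * (ν + 1) * (μ + 1) * b = 0 := by simpa using congr_fun h 0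
    exact mul_ne_zero hν₂ hb (by linarith)
  all_goals
    ext k
    rw [Entry.bracket_g80]
    fin_cases k <;> simp [ee] <;> linarith

theorem Entry.exists_isFiliformChain_g90 {a b c d l : ℝ} (hl : l ≠ 0) {a₅ a₆ a₇ δ : ℝ}
    (h₅ : b = a₅ * l) (h₆ : -a = -a₅ * b - a₆ * l) (h₇ : -c = a₅ * d + a₆ * b + a₇ * l)
    (hδ : b = δ * l) :
    ∃ X, IsFiliformChain (L := (Entry.g90 a b c d l hl).Algebra) X 0 0 a₅ a₆ a₇ δ := by
  refine ⟨_, Entry.isFiliformChain_of_bracket _ (X := ![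
    ![0, 0, 0, 0, 1, 0, 0, 0], ![0, 1, 0, 0, 0, 0, 0, 0], ![0, 0, 1, 0, 0, 0, 0, -d],
    ![0, 0, 0, 1, 0, 0, d, -b], ![0, 0, 0, 0, 0, -d, b, -l], ![d, 0, 0, 0, 0, -b, l, 0],
    ![b, 0, 0, 0, 0, -l, 0, 0], ![l, 0, 0, 0, 0, 0, 0, 0]]) ?_ ?_ ?_ ?_ ?_ ?_ ?_ ?_ ?_ ?_ ?_⟩
  case refine_11 =>
    intro h
    exact hl (by simpa using congr_fun h 0)
  all_goals
    ext k
    rw [Entry.bracket_g90]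
    fin_cases k <;> simp [ee] <;> linarith

theorem Entry.exists_isFiliformChain_g91 {a b c d l : ℝ} (hbd : b - d ≠ 0) {a₅ a₆ a₇ δ : ℝ}
    (h₅ : b = a₅ * (b - d)) (h₆ : a = a₅ * (b - d - d) - a₆ * (b - d))
    (h₇ : l = a₅ * (c + a + l) - a₆ * (b - d - d) + a₇ * (b - d))
    (hδ : d = δ * (b - d)) :
    ∃ X, IsFiliformChain (L := (Entry.g91 a b c d l hbd).Algebra) X 0 0 a₅ a₆ a₇ δ := by
  refine ⟨_, Entry.isFiliformChain_of_bracket _ (X := ![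
    ![0, 0, 0, 0, 1, 0, 0, 0], ![0, 1, 0, 0, 0, 0, 0, 0], ![0, 0, 1, 0, 0, 0, 0, -l],
    ![0, 0, 0, 1, 0, l, l, a], ![-l, 0, 0, 0, 0, -(c + a + l), d, -(b - d)],
    ![c + a + l, 0, 0, 0, 0, b - d - d, b - d, 0],
    ![-(b - d - d), 0, 0, 0, 0, -(b - d), 0, 0],
    ![b - d, 0, 0, 0, 0, 0, 0, 0]]) ?_ ?_ ?_ ?_ ?_ ?_ ?_ ?_ ?_ ?_ ?_⟩
  case refine_11 =>
    intro h
    exact hbd (by simpa using congr_fun h 0)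
  all_goals
    ext k
    rw [Entry.bracket_g91]
    fin_cases k <;> simp [ee] <;> linarith

theorem Entry.exists_isFiliformChain_g93 {a b c d l : ℝ} (hb : b ≠ 0) {a₅ a₆ a₇ δ : ℝ}
    (h₅ : 4 * a = -(2 / 15 * a₅ * b))
    (h₆ : c = 5 * (d + 2 / 5 * c) + a₅ * a + 2 / 15 * a₆ * b)
    (h₇ : 0 = -(5 * l) - a₅ * (d + 2 / 5 * c) - a₆ * a - 2 / 15 * a₇ * b)
    (hδ : 3 / 2 * a = -(2 / 15 * δ * b)) :
    ∃ X, IsFiliformChain (L := (Entry.g93 a b c d l hb).Algebra) X 5 (5 / 2) a₅ a₆ a₇ δ := by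
  refine ⟨_, Entry.isFiliformChain_of_bracket _ (X := ![
    ![0, 0, 0, 0, 1, 0, 0, 0], ![0, 1, 0, 0, 0, 0, 0, 0], ![0, 0, 1, 0, 0, 0, 0, -(3 / 5 * c)],
    ![0, 0, 0, 1, 0, 0, -(2 / 5 * c), -(3 / 5 * a)],
    ![-l, 0, 0, 0, 0, d + 2 / 5 * c, -a, -(1 / 5 * b)],
    ![-(d + 2 / 5 * c), 0, 0, 0, 0, a, -(2 / 15 * b), 0],
    ![-a, 0, 0, 0, 0, 2 / 15 * b, 0, 0],
    ![-(2 / 15 * b), 0, 0, 0, 0, 0, 0, 0]]) ?_ ?_ ?_ ?_ ?_ ?_ ?_ ?_ ?_ ?_ ?_⟩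
  case refine_11 =>
    intro h
    exact hb (by simpa using congr_fun h 0)
  all_goals
    ext k
    rw [Entry.bracket_g93]
    fin_cases k <;> simp [ee] <;> linarith

set_option maxHeartbeats 1000000 in
theorem Entry.exists_isFiliformChain_g95 {a b c d l κ f : ℝ} (hb : b ≠ 0) {a₅ a₆ a₇ δ : ℝ}
    (hκ : κ = 3 / 5 * a - b + 3 / 5 * c)
    (hf : f = d - 5 / 3 * (3 / 5 * a - b) + 2 / 3 * κ)
    (h₅ : 2 / 15 * a₅ * b = 10 * b - 4 * a)
    (h₆ : 5 / 3 * κ = 5 * f + a₅ * (a - 7 / 3 * b) + 2 / 15 * a₆ * b)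
    (h₇ : -(5 / 3 * κ) = 5 * (5 / 3 * κ - l) - a₅ * f - a₆ * (a - 7 / 3 * b) - 2 / 15 * a₇ * b)
    (hδ : 2 / 15 * δ * b = 23 / 6 * b - 3 / 2 * a) :
    ∃ X, IsFiliformChain (L := (Entry.g95 a b c d l hb).Algebra) X 5 (5 / 2) a₅ a₆ a₇ δ := by
  refine ⟨_, Entry.isFiliformChain_of_bracket _ (X := ![
    ![0, 0, 0, 0, 1, 0, 0, 0], ![0, 1, 0, 0, 0, 0, 0, 0], ![0, 0, 1, 0, 0, 0, 0, -κ],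
    ![0, 0, 0, 1, 0, -(5 / 3 * κ), -(2 / 3 * κ), -(3 / 5 * a - b)],
    ![5 / 3 * κ - l, 0, 0, 0, 0, f, 2 * b - a, -(1 / 5 * b)],
    ![-f, 0, 0, 0, 0, a - 7 / 3 * b, -(2 / 15 * b), 0],
    ![-(a - 7 / 3 * b), 0, 0, 0, 0, 2 / 15 * b, 0, 0],
    ![-(2 / 15 * b), 0, 0, 0, 0, 0, 0, 0]]) ?_ ?_ ?_ ?_ ?_ ?_ ?_ ?_ ?_ ?_ ?_⟩
  case refine_11 =>
    intro h
    exact hb (by simpa using congr_fun h 0)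
  all_goals
    ext k
    rw [Entry.bracket_g95]
    fin_cases k <;> simp [ee] <;> linarith

/-! ### The algebras of the list are filiform and symplectic. -/

section Filiform

variable {L : Type*} [LieRing L] [LieAlgebra ℝ L] {X : Fin 8 → L} {α β a₅ a₆ a₇ δ : ℝ}

theorem lie_mem_of_mem_span {ι : Type*} {X : ι → L} (hX : Submodule.span ℝ (Set.range X) = ⊤)
    {s : Set ι} {N : Submodule ℝ L} (h : ∀ i, ∀ j ∈ s, ⁅X i, X j⁆ ∈ N) (x : L) {y : L}
    (hy : y ∈ Submodule.span ℝ (X '' s)) : ⁅x, y⁆ ∈ N := by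
  have hx : x ∈ Submodule.span ℝ (Set.range X) := hX ▸ Submodule.mem_top
  induction hy using Submodule.span_induction with
  | mem y hy =>
    obtain ⟨j, hj, rfl⟩ := hy
    induction hx using Submodule.span_induction with
    | mem x hx =>
      obtain ⟨i, rfl⟩ := hx
      exact h i j hj
    | zero => rw [zero_lie]; exact zero_mem _
    | add u v _ _ hu hv => rw [add_lie]; exact add_mem hu hv
    | smul c u _ hu => rw [smul_lie]; exact N.smul_mem c hu
  | zero => rw [lie_zero]; exact zero_mem _
  | add u v _ _ hu hv => rw [lie_add]; exact add_mem hu hv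
  | smul c u _ hu => rw [lie_smul]; exact N.smul_mem c hu

/-- The span `T k` of the `X m` with `m > k` contains the lower central term of index `k` for `k ≥
1`, because a bracket of two distinct basis vectors involves only indices above both. So the term of
index 7 vanishes, while `X 7 ≠ 0` lies in that of index 6. -/
theorem IsFiliformChain.isFiliform (h : IsFiliformChain X α β a₅ a₆ a₇ δ)
    (hd : Module.finrank ℝ L = 8) : IsFiliform L := by
  obtain ⟨T, hT⟩ : ∃ T : ℕ → Submodule ℝ L,
    ∀ k, T k = Submodule.span ℝ (X '' {m | k < (m : ℕ)}) := ⟨_, fun _ => rfl⟩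
  have hmem : ∀ (k : ℕ) (m : Fin 8), k < (m : ℕ) → X m ∈ T k := fun k m hm => by
    rw [hT]
    exact Submodule.subset_span ⟨m, hm, rfl⟩
  have hanti : ∀ {k l : ℕ}, k ≤ l → T l ≤ T k := fun {k l} hkl => by
    rw [hT, hT]
    exact Submodule.span_mono (Set.image_mono fun m (hm : l < (m : ℕ)) => hkl.trans_lt hm)
  have hlt : ∀ i j : Fin 8, i < j → ⁅X i, X j⁆ ∈ T j := by
    intro i j hij
    fin_cases i <;> fin_cases j <;> first
      | exact absurd hij (by decide)
      | (simp only [Fin.reduceFinMk, Fin.zero_eta, Fin.mk_one, Fin.isValue, h.lie01, h.lie02,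
          h.lie03, h.lie04, h.lie05, h.lie06, h.lie07, h.lie12, h.lie13, h.lie14, h.lie15, h.lie16,
          h.lie17, h.lie23, h.lie24, h.lie25, h.lie26, h.lie27, h.lie34, h.lie35, h.lie36,
          h.lie37, h.lie45, h.lie46, h.lie47, h.lie56, h.lie57, h.lie67]
         repeat' first
          | exact zero_mem _
          | exact hmem _ _ (by decide)
          | apply Submodule.smul_mem
          | apply Submodule.add_mem)
  have hne : ∀ i j : Fin 8, i ≠ j → ⁅X i, X j⁆ ∈ T (max i j) := by
    intro i j hij
    rcases lt_or_gt_of_ne hij with hl | hl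
    · rw [max_eq_right (Fin.le_def.mp hl.le)]
      exact hlt i j hl
    · rw [max_eq_left (Fin.le_def.mp hl.le), ← lie_skew]
      exact neg_mem (hlt j i hl)
  have hspan : Submodule.span ℝ (Set.range X) = ⊤ := by
    rw [← h.coe_basis hd]
    exact (h.basis hd).span_eq
  have h1 : ∀ x y : L, ⁅x, y⁆ ∈ T 1 := by
    intro x y
    refine lie_mem_of_mem_span hspan (s := Set.univ) (fun i j _ => ?_) x (y := y)
      (by rw [Set.image_univ, hspan]; exact Submodule.mem_top)
    rcases eq_or_ne i j with rfl | hij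
    · rw [lie_self]; exact zero_mem _
    · exact hanti (by omega) (hne i j hij)
  have hlcs : ∀ k, ((LieModule.lowerCentralSeries ℝ L L (k + 1)).toSubmodule) ≤ T (k + 1) := by
    intro k
    induction k with
    | zero =>
      rw [LieModule.lowerCentralSeries_succ, LieSubmodule.lieIdeal_oper_eq_linear_span']
      refine Submodule.span_le.mpr ?_
      rintro _ ⟨x, -, y, -, rfl⟩
      exact h1 x y
    | succ k ih =>
      rw [LieModule.lowerCentralSeries_succ, LieSubmodule.lieIdeal_oper_eq_linear_span']
      refine Submodule.span_le.mpr ?_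
      rintro _ ⟨x, -, y, hy, rfl⟩
      have hy' := ih hy
      rw [hT] at hy'
      refine lie_mem_of_mem_span hspan (fun i j (hj : k + 1 < (j : ℕ)) => ?_) x hy'
      rcases eq_or_ne i j with rfl | hij
      · rw [lie_self]; exact zero_mem _
      · exact hanti ((Nat.succ_le_of_lt hj).trans (le_max_right _ _)) (hne i j hij)
  have h7 : LieModule.lowerCentralSeries ℝ L L 7 = ⊥ := by
    rw [← LieSubmodule.toSubmodule_eq_bot, eq_bot_iff]
    refine (hlcs 6).trans ?_
    rw [hT, Submodule.span_le]
    rintro _ ⟨m, hm, rfl⟩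
    exact absurd m.2 (not_lt.mpr hm)
  have m2 : X 2 ∈ LieModule.lowerCentralSeries ℝ L L 1 :=
    h.lie01 ▸ lie_mem_lowerCentralSeries_succ (X 0) (k := 0) (LieSubmodule.mem_top _)
  have m3 := lie_mem_lowerCentralSeries_succ (X 0) m2
  rw [h.lie02] at m3
  have m4 := lie_mem_lowerCentralSeries_succ (X 0) m3
  rw [h.lie03] at m4
  have m5 := lie_mem_lowerCentralSeries_succ (X 0) m4
  rw [h.lie04] at m5
  have m6 := lie_mem_lowerCentralSeries_succ (X 0) m5
  rw [h.lie05] at m6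
  have m7 : X 7 ∈ LieModule.lowerCentralSeries ℝ L L 6 :=
    h.lie06 ▸ lie_mem_lowerCentralSeries_succ (X 0) m6
  refine ⟨(LieModule.isNilpotent_iff ℝ L L).mpr ⟨7, h7⟩, ?_⟩
  rw [(LieModule.nilpotencyLength_eq_succ_iff ℝ L L 6).mpr ⟨h7, fun h6 => h.ne_zero ?_⟩, hd]
  rwa [h6, LieSubmodule.mem_bot] at m7

end Filiform

theorem Entry.form_apply (R : Entry) (x y : Fin 8 → ℝ) :
    R.form (x : R.Algebra) (y : R.Algebra) = R.kappa.1 * ee 1 3 x y + ee 1 5 x y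
      + R.kappa.2 * ee 2 3 x y + ee 2 6 x y + ee 3 7 x y + ee 4 8 x y := rfl

theorem Entry.form_self (R : Entry) (x : Fin 8 → ℝ) :
    R.form (x : R.Algebra) (x : R.Algebra) = 0 := by
  rw [R.form_apply x x]
  simp only [ee_self, mul_zero, add_zero]

theorem Entry.eq_zero_of_form_eq_zero (R : Entry) (x : Fin 8 → ℝ)
    (hx : ∀ y : Fin 8 → ℝ, R.form (x : R.Algebra) (y : R.Algebra) = 0) : x = 0 := by
  simp only [R.form_apply] at hx
  have h0 := hx (e 0)
  have h1 := hx (e 1)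
  have h2 := hx (e 2)
  have h3 := hx (e 3)
  have h4 := hx (e 4)
  have h5 := hx (e 5)
  have h6 := hx (e 6)
  have h7 := hx (e 7)
  simp [ee, e] at h0 h1 h2 h3 h4 h5 h6 h7
  simp [h5, h6, h7] at h1 h2 h3
  ext k
  fin_cases k <;> assumption

theorem Entry.form_closed (R : Entry) (x y z : Fin 8 → ℝ) :
    R.form (x : R.Algebra) (R.bracket y z : R.Algebra)
      + R.form (y : R.Algebra) (R.bracket z x : R.Algebra)
      + R.form (z : R.Algebra) (R.bracket x y : R.Algebra) = 0 := by
  simp only [Entry.form_apply]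
  cases R with
  | g80 a b c d l μ μ₁ ν hν hrel hμ hb =>
    obtain rfl : μ₁ = ν * (μ - 1) + μ := by linarith
    simp only [Entry.bracket_g80, Entry.kappa]
    simp [ee]
    ring
  | g90 a b c d l hl =>
    simp only [Entry.bracket_g90, Entry.kappa]
    simp [ee]
    ring
  | g91 a b c d l hbd =>
    simp only [Entry.bracket_g91, Entry.kappa]
    simp [ee]
    ring
  | g93 a b c d l hb =>
    simp only [Entry.bracket_g93, Entry.kappa]
    simp [ee]
    ring
  | g95 a b c d l hb =>
    simp only [Entry.bracket_g95, Entry.kappa]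
    simp [ee]
    ring

theorem Entry.isSymplecticForm_form (R : Entry) : IsSymplecticForm R.form where
  isAlt := R.form_self
  nondegenerate := by
    refine ⟨R.eq_zero_of_form_eq_zero, fun y hy => R.eq_zero_of_form_eq_zero y fun x => ?_⟩
    have halt : R.form.IsAlt := R.form_self
    exact (halt.neg_eq x y).symm.trans (neg_eq_zero.mpr (hy x))
  closed := R.form_closed

/-- At ν = -2 the quadratic relation forces μ = -1. -/
theorem Entry.g80_add_two_ne_zero {b μ ν : ℝ} (hrel : 2 * μ * (ν + 1) = ν * (3 * ν + 5))
    (hb : b * (ν + 1) * (μ + 1) ≠ 0) : ν + 2 ≠ 0 := by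
  intro h
  obtain rfl : ν = -2 := by linarith
  exact right_ne_zero_of_mul hb (by linarith)

theorem Entry.isFiliform (R : Entry) : IsFiliform R.Algebra := by
  suffices h : ∃ (X : Fin 8 → R.Algebra) (α β a₅ a₆ a₇ δ : ℝ), IsFiliformChain X α β a₅ a₆ a₇ δ by
    obtain ⟨X, α, β, a₅, a₆, a₇, δ, h⟩ := h
    exact h.isFiliform R.finrank_algebra
  cases R with
  | g80 a b c d l μ μ₁ ν hν hrel hμ hb =>
    have hν₂ := Entry.g80_add_two_ne_zero hrel hb
    have hb₀ := left_ne_zero_of_mul (left_ne_zero_of_mul hb)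
    have hν₁ := right_ne_zero_of_mul (left_ne_zero_of_mul hb)
    have hμ₁ := right_ne_zero_of_mul hb
    -- The conditions on the structure constants form a triangular linear system whose pivots are
    -- nonzero by the restrictions on the parameters.
    obtain ⟨α, hα⟩ : ∃ α, ν * b = -(α * (ν + 2) * b) := ⟨-ν / (ν + 2), by field_simp⟩
    obtain ⟨a₅, h₅⟩ : ∃ a₅, (μ₁ - 1) * a
        = -(α * (ν + 1) * (μ + 1) * a) + a₅ * (ν + 2) * (ν + 1) * b :=
      ⟨((μ₁ - 1) * a + α * (ν + 1) * (μ + 1) * a) / ((ν + 2) * (ν + 1) * b), by field_simp; ring⟩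
    obtain ⟨a₆, h₆⟩ : ∃ a₆, ν * l - d + l * μ₁ = -(α * l * (ν + 1) * (μ + 1))
        + a₅ * (ν + 1) * (μ + 1) ^ 2 * a - a₆ * (ν + 2) * (ν + 1) * (μ + 1) * b :=
      ⟨(-(ν * l - d + l * μ₁) - α * l * (ν + 1) * (μ + 1) + a₅ * (ν + 1) * (μ + 1) ^ 2 * a)
        / ((ν + 2) * (ν + 1) * (μ + 1) * b), by field_simp; ring⟩
    obtain ⟨a₇, h₇⟩ : ∃ a₇, c = a₅ * l * (ν + 1) * (μ + 1) - a₆ * (ν + 1) * (μ + 1) ^ 2 * a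
        + a₇ * (ν + 2) * (ν + 1) * (μ + 1) * b :=
      ⟨(c - a₅ * l * (ν + 1) * (μ + 1) + a₆ * (ν + 1) * (μ + 1) ^ 2 * a)
        / ((ν + 2) * (ν + 1) * (μ + 1) * b), by field_simp; ring⟩
    obtain ⟨β, hβ⟩ : ∃ β, ν * (ν + 2) * b = β * (ν + 2) * (ν + 1) * (μ + 1) * b :=
      ⟨ν / ((ν + 1) * (μ + 1)), by field_simp⟩
    obtain ⟨δ, hδ⟩ : ∃ δ, -((ν + 1) * (μ + 1) * a) = -(β * (ν + 1) * (μ + 1) ^ 2 * a)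
        + δ * (ν + 2) * (ν + 1) * (μ + 1) * b :=
      ⟨(-((ν + 1) * (μ + 1) * a) + β * (ν + 1) * (μ + 1) ^ 2 * a)
        / ((ν + 2) * (ν + 1) * (μ + 1) * b), by field_simp; ring⟩
    obtain ⟨X, hX⟩ := Entry.exists_isFiliformChain_g80 hν hrel hμ hb hν₂ hα h₅ h₆ h₇ hβ hδ
    exact ⟨X, _, _, _, _, _, _, hX⟩
  | g90 a b c d l hl =>
    obtain ⟨a₅, h₅⟩ : ∃ a₅, b = a₅ * l := ⟨b / l, by field_simp⟩
    obtain ⟨a₆, h₆⟩ : ∃ a₆, -a = -a₅ * b - a₆ * l := ⟨(a - a₅ * b) / l, by field_simp; ring⟩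
    obtain ⟨a₇, h₇⟩ : ∃ a₇, -c = a₅ * d + a₆ * b + a₇ * l :=
      ⟨(-c - a₅ * d - a₆ * b) / l, by field_simp; ring⟩
    obtain ⟨X, hX⟩ := Entry.exists_isFiliformChain_g90 hl h₅ h₆ h₇ h₅
    exact ⟨X, _, _, _, _, _, _, hX⟩
  | g91 a b c d l hbd =>
    obtain ⟨a₅, h₅⟩ : ∃ a₅, b = a₅ * (b - d) := ⟨b / (b - d), by field_simp⟩
    obtain ⟨a₆, h₆⟩ : ∃ a₆, a = a₅ * (b - d - d) - a₆ * (b - d) :=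
      ⟨(a₅ * (b - d - d) - a) / (b - d), by field_simp; ring⟩
    obtain ⟨a₇, h₇⟩ : ∃ a₇, l = a₅ * (c + a + l) - a₆ * (b - d - d) + a₇ * (b - d) :=
      ⟨(l - a₅ * (c + a + l) + a₆ * (b - d - d)) / (b - d), by field_simp; ring⟩
    obtain ⟨δ, hδ⟩ : ∃ δ, d = δ * (b - d) := ⟨d / (b - d), by field_simp⟩
    obtain ⟨X, hX⟩ := Entry.exists_isFiliformChain_g91 hbd h₅ h₆ h₇ hδ
    exact ⟨X, _, _, _, _, _, _, hX⟩
  | g93 a b c d l hb =>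
    obtain ⟨a₅, h₅⟩ : ∃ a₅, 4 * a = -(2 / 15 * a₅ * b) := ⟨-30 * a / b, by field_simp; ring⟩
    obtain ⟨a₆, h₆⟩ : ∃ a₆, c = 5 * (d + 2 / 5 * c) + a₅ * a + 2 / 15 * a₆ * b :=
      ⟨15 / 2 * (c - 5 * (d + 2 / 5 * c) - a₅ * a) / b, by field_simp; ring⟩
    obtain ⟨a₇, h₇⟩ : ∃ a₇, 0 = -(5 * l) - a₅ * (d + 2 / 5 * c) - a₆ * a - 2 / 15 * a₇ * b :=
      ⟨15 / 2 * (-(5 * l) - a₅ * (d + 2 / 5 * c) - a₆ * a) / b, by field_simp; ring⟩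
    obtain ⟨δ, hδ⟩ : ∃ δ, 3 / 2 * a = -(2 / 15 * δ * b) := ⟨-45 / 4 * a / b, by field_simp; ring⟩
    obtain ⟨X, hX⟩ := Entry.exists_isFiliformChain_g93 hb h₅ h₆ h₇ hδ
    exact ⟨X, _, _, _, _, _, _, hX⟩
  | g95 a b c d l hb =>
    obtain ⟨κ, hκ⟩ : ∃ κ, κ = 3 / 5 * a - b + 3 / 5 * c := ⟨_, rfl⟩
    obtain ⟨f, hf⟩ : ∃ f, f = d - 5 / 3 * (3 / 5 * a - b) + 2 / 3 * κ := ⟨_, rfl⟩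
    obtain ⟨a₅, h₅⟩ : ∃ a₅, 2 / 15 * a₅ * b = 10 * b - 4 * a :=
      ⟨15 / 2 * (10 * b - 4 * a) / b, by field_simp⟩
    obtain ⟨a₆, h₆⟩ : ∃ a₆, 5 / 3 * κ = 5 * f + a₅ * (a - 7 / 3 * b) + 2 / 15 * a₆ * b :=
      ⟨15 / 2 * (5 / 3 * κ - 5 * f - a₅ * (a - 7 / 3 * b)) / b, by field_simp; ring⟩
    obtain ⟨a₇, h₇⟩ : ∃ a₇, -(5 / 3 * κ) = 5 * (5 / 3 * κ - l) - a₅ * f - a₆ * (a - 7 / 3 * b)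
        - 2 / 15 * a₇ * b :=
      ⟨15 / 2 * (5 / 3 * κ + 5 * (5 / 3 * κ - l) - a₅ * f - a₆ * (a - 7 / 3 * b)) / b, by
        field_simp; ring⟩
    obtain ⟨δ, hδ⟩ : ∃ δ, 2 / 15 * δ * b = 23 / 6 * b - 3 / 2 * a :=
      ⟨15 / 2 * (23 / 6 * b - 3 / 2 * a) / b, by field_simp⟩
    obtain ⟨X, hX⟩ := Entry.exists_isFiliformChain_g95 hb hκ hf h₅ h₆ h₇ hδ
    exact ⟨X, _, _, _, _, _, _, hX⟩

/-! ### Matching every admissible chain with an entry. -/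

section Classification

variable {L : Type*} [LieRing L] [LieAlgebra ℝ L] {X : Fin 8 → L} {α β a₅ a₆ a₇ δ : ℝ}

/-- The chains of `g90` have a₅ = δ and those of `g91` have a₅ - δ = 1, which rescaling achieves
when a₅ ≠ δ. -/
theorem IsFiliformChain.exists_entry_of_eq_zero (h : IsFiliformChain X 0 0 a₅ a₆ a₇ δ)
    (hd : Module.finrank ℝ L = 8) : ∃ R : Entry, Nonempty (L ≃ₗ⁅ℝ⁆ R.Algebra) := by
  by_cases h₅ : a₅ = δ
  · subst h₅
    obtain ⟨Y, hY⟩ := Entry.exists_isFiliformChain_g90 (a := a₅ * a₅ + a₆) (b := a₅)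
      (c := -(a₆ * a₅ + a₇)) (d := 0) (l := 1) one_ne_zero (a₅ := a₅) (a₆ := a₆) (a₇ := a₇)
      (δ := a₅) (by ring) (by ring) (by ring) (by ring)
    exact ⟨_, h.nonempty_lieEquiv hY hd (Entry.finrank_algebra _)⟩
  · have hne : a₅ - δ ≠ 0 := sub_ne_zero.mpr h₅
    have h' := h.scale one_ne_zero (inv_ne_zero hne)
    simp only [one_pow, div_one, mul_zero] at h'
    obtain ⟨b₅, hb₅⟩ : ∃ b, b = (a₅ - δ)⁻¹ * a₅ := ⟨_, rfl⟩
    obtain ⟨b₆, hb₆⟩ : ∃ b, b = (a₅ - δ)⁻¹ * a₆ := ⟨_, rfl⟩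
    obtain ⟨b₇, hb₇⟩ : ∃ b, b = (a₅ - δ)⁻¹ * a₇ := ⟨_, rfl⟩
    obtain ⟨ε, hε⟩ : ∃ b, b = (a₅ - δ)⁻¹ * δ := ⟨_, rfl⟩
    have h1 : b₅ - ε = 1 := by rw [hb₅, hε, ← mul_sub, inv_mul_cancel₀ hne]
    rw [← hb₅, ← hb₆, ← hb₇, ← hε] at h'
    obtain rfl : b₅ = 1 + ε := by linarith
    obtain ⟨l, hl⟩ : ∃ l, l = -(b₆ * (1 - ε)) + b₇ := ⟨_, rfl⟩
    obtain ⟨a, ha⟩ : ∃ a, a = (1 + ε) * (1 - ε) - b₆ := ⟨_, rfl⟩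
    -- The choice of `c` makes `c + a + l` vanish, so the equation for a₇ determines `l`.
    obtain ⟨Y, hY⟩ := Entry.exists_isFiliformChain_g91 (a := a) (b := 1 + ε) (c := -a - l)
      (d := ε) (l := l) (by simp) (a₅ := 1 + ε) (a₆ := b₆) (a₇ := b₇) (δ := ε)
      (by ring) (by rw [ha]; ring) (by rw [hl]; ring) (by ring)
    exact ⟨_, h'.nonempty_lieEquiv hY hd (Entry.finrank_algebra _)⟩

/-- Eliminating `a` from the conditions on a₅ and δ leaves 3a₅ - 8δ = 0 for `g93` and -5 for `g95`.
With `b = 1` and `c = 0`, the parameters `a`, `d`, `l` then match a₅, a₆, a₇ in turn. -/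
theorem IsFiliformChain.exists_entry_of_eq_five (h : IsFiliformChain X 5 (5 / 2) a₅ a₆ a₇ δ)
    (hd : Module.finrank ℝ L = 8) (h₅ : 3 * a₅ - 8 * δ = 0 ∨ 3 * a₅ - 8 * δ = -5) :
    ∃ R : Entry, Nonempty (L ≃ₗ⁅ℝ⁆ R.Algebra) := by
  rcases h₅ with h₅ | h₅
  · obtain ⟨a, ha⟩ : ∃ a, a = -a₅ / 30 := ⟨_, rfl⟩
    obtain ⟨d, hd'⟩ : ∃ d, 0 = 5 * d + a₅ * a + 2 / 15 * a₆ :=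
      ⟨-(a₅ * a + 2 / 15 * a₆) / 5, by ring⟩
    obtain ⟨l, hl⟩ : ∃ l, 0 = -(5 * l) - a₅ * d - a₆ * a - 2 / 15 * a₇ :=
      ⟨(-(a₅ * d) - a₆ * a - 2 / 15 * a₇) / 5, by ring⟩
    obtain ⟨Y, hY⟩ := Entry.exists_isFiliformChain_g93 (a := a) (b := 1) (c := 0) (d := d)
      (l := l) one_ne_zero (a₅ := a₅) (a₆ := a₆) (a₇ := a₇) (δ := δ) (by linarith)
      (by linarith) (by linarith) (by linarith)
    exact ⟨_, h.nonempty_lieEquiv hY hd (Entry.finrank_algebra _)⟩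
  · obtain ⟨a, ha⟩ : ∃ a, a = (10 - 2 / 15 * a₅) / 4 := ⟨_, rfl⟩
    obtain ⟨κ, hκ⟩ : ∃ κ, κ = 3 / 5 * a - 1 + 3 / 5 * 0 := ⟨_, rfl⟩
    obtain ⟨f, hf⟩ : ∃ f, 5 / 3 * κ = 5 * f + a₅ * (a - 7 / 3 * 1) + 2 / 15 * a₆ * 1 :=
      ⟨(5 / 3 * κ - a₅ * (a - 7 / 3 * 1) - 2 / 15 * a₆ * 1) / 5, by ring⟩
    obtain ⟨d, hd'⟩ : ∃ d, f = d - 5 / 3 * (3 / 5 * a - 1) + 2 / 3 * κ :=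
      ⟨f + 5 / 3 * (3 / 5 * a - 1) - 2 / 3 * κ, by ring⟩
    obtain ⟨l, hl⟩ : ∃ l, -(5 / 3 * κ) = 5 * (5 / 3 * κ - l) - a₅ * f - a₆ * (a - 7 / 3 * 1)
        - 2 / 15 * a₇ * 1 :=
      ⟨(5 / 3 * κ + 25 / 3 * κ - a₅ * f - a₆ * (a - 7 / 3 * 1) - 2 / 15 * a₇ * 1) / 5, by ring⟩
    obtain ⟨Y, hY⟩ := Entry.exists_isFiliformChain_g95 (a := a) (b := 1) (c := 0) (d := d)
      (l := l) one_ne_zero (a₅ := a₅) (a₆ := a₆) (a₇ := a₇) (δ := δ) hκ hd' (by linarith) hf hl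
      (by linarith)
    exact ⟨_, h.nonempty_lieEquiv hY hd (Entry.finrank_algebra _)⟩

theorem IsFiliformChain.exists_entry_of_eq_two_mul (h : IsFiliformChain X (2 * β) β a₅ a₆ a₇ δ)
    (hd : Module.finrank ℝ L = 8) (hβ : β ≠ 0) :
    ∃ R : Entry, Nonempty (L ≃ₗ⁅ℝ⁆ R.Algebra) := by
  obtain ⟨p, hp, hp₅⟩ : ∃ p : ℝ, p ≠ 0 ∧
      (3 * a₅ - 8 * δ = 0 ∨ 3 * a₅ - 8 * δ = -(2 * β * p)) := by
    by_cases h0 : 3 * a₅ - 8 * δ = 0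
    · exact ⟨1, one_ne_zero, Or.inl h0⟩
    · exact ⟨-(3 * a₅ - 8 * δ) / (2 * β), div_ne_zero (neg_ne_zero.mpr h0) (by positivity), Or.inr (by field_simp)⟩
  -- `q` turns (α, β) into (5, 5/2) for every `p`; `p` was chosen so that a nonzero 3a₅ - 8δ becomes
  -- -5.
  have h' := h.scale hp (q := 5 * p ^ 2 / (2 * β)) (by positivity)
  rw [show 5 * p ^ 2 / (2 * β) / p ^ 2 * (2 * β) = 5 by field_simp,
    show 5 * p ^ 2 / (2 * β) / p ^ 2 * β = 5 / 2 by field_simp] at h'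
  refine h'.exists_entry_of_eq_five hd (hp₅.imp (fun h0 => ?_) fun h0 => ?_)
  · linear_combination (5 * p ^ 2 / (2 * β) / p ^ 3) * h0
  · have h1 : 3 * (5 * p ^ 2 / (2 * β) / p ^ 3 * a₅) - 8 * (5 * p ^ 2 / (2 * β) / p ^ 3 * δ)
        = (5 * p ^ 2 / (2 * β) / p ^ 3) * (3 * a₅ - 8 * δ) := by ring
    rw [h1, h0]
    field_simp

/-- In `g80` a single parameter `a` governs both a₅ and δ, so a₅ = -(ν - 1)δ must hold. A shift
achieves this because ν and 3ν + 5 are nonzero; `d` and `c` then match a₆ and a₇. -/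
theorem IsFiliformChain.exists_entry_of_parameter {ν : ℝ} (hν₀ : ν ≠ 0) (hν₁ : ν + 1 ≠ 0)
    (hν₂ : ν + 2 ≠ 0) (hν₃ : 3 * ν + 1 ≠ 0) (hν₅ : 3 * ν + 5 ≠ 0)
    (h : IsFiliformChain X (-ν / (ν + 2)) (2 * ν / ((3 * ν + 1) * (ν + 2))) a₅ a₆ a₇ δ)
    (hd : Module.finrank ℝ L = 8) : ∃ R : Entry, Nonempty (L ≃ₗ⁅ℝ⁆ R.Algebra) := by
  have hν₃' : ν * 3 + 1 ≠ 0 := by rwa [mul_comm]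
  have hν₅' : ν * 3 + 5 ≠ 0 := by rwa [mul_comm]
  -- This is a₅' + (ν - 1)δ' = 0 for the shifted constants, with denominators cleared.
  obtain ⟨t, ht⟩ : ∃ t : ℝ, t * (4 * ν ^ 2 * (3 * ν + 5))
      = (a₅ + (ν - 1) * δ) * ((ν + 2) ^ 2 * (3 * ν + 1) ^ 2) :=
    ⟨(a₅ + (ν - 1) * δ) * ((ν + 2) ^ 2 * (3 * ν + 1) ^ 2) / (4 * ν ^ 2 * (3 * ν + 5)), by
      field_simp⟩
  obtain ⟨X', b₆, b₇, h'⟩ := h.exists_shift t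
  obtain ⟨ε, hε⟩ : ∃ ε, ε = δ - 3 * t * (2 * ν / ((3 * ν + 1) * (ν + 2)))
    * (-ν / (ν + 2) - 2 * ν / ((3 * ν + 1) * (ν + 2))) := ⟨_, rfl⟩
  have hb₅ : a₅ - 2 * t * (-ν / (ν + 2)) ^ 2 = -((ν - 1) * ε) := by
    rw [hε]
    field_simp
    linear_combination -ht
  rw [← hε, hb₅] at h'
  obtain ⟨μ, hμ⟩ : ∃ μ, μ = ν * (3 * ν + 5) / (2 * (ν + 1)) := ⟨_, rfl⟩
  have hμ1 : μ + 1 = (3 * ν + 1) * (ν + 2) / (2 * (ν + 1)) := by rw [hμ]; field_simp; ring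
  obtain ⟨a, ha⟩ : ∃ a, a = -(ε * (ν + 2) * (ν + 1)) := ⟨_, rfl⟩
  have hrel : 2 * μ * (ν + 1) = ν * (3 * ν + 5) := by rw [hμ]; field_simp
  have hμ0 : μ ≠ 0 := by rw [hμ]; positivity
  have hμ1' : μ + 1 ≠ 0 := by rw [hμ1]; positivity
  obtain ⟨Y, hY⟩ := Entry.exists_isFiliformChain_g80 (a := a) (b := 1)
    (c := -(b₆ * (ν + 1) * (μ + 1) ^ 2 * a) + b₇ * (ν + 2) * (ν + 1) * (μ + 1))
    (d := (ν - 1) * ε * (ν + 1) * (μ + 1) ^ 2 * a + b₆ * (ν + 2) * (ν + 1) * (μ + 1))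
    (l := 0) (μ := μ) (μ₁ := ν * (μ - 1) + μ) (ν := ν) (by ring) hrel hμ0
    (by simp [hν₁, hμ1']) hν₂ (α := -ν / (ν + 2)) (β := 2 * ν / ((3 * ν + 1) * (ν + 2)))
    (a₅ := -((ν - 1) * ε)) (a₆ := b₆) (a₇ := b₇) (δ := ε)
    (by field_simp) (by rw [hμ1, hμ, ha]; field_simp; ring) (by ring) (by ring)
    (by rw [hμ1]; field_simp) (by rw [hμ1, ha]; field_simp)
  exact ⟨_, h'.nonempty_lieEquiv hY hd (Entry.finrank_algebra _)⟩

theorem IsFiliformChain.exists_entry (h : IsFiliformChain X α β a₅ a₆ a₇ δ)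
    (hd : Module.finrank ℝ L = 8)
    (hαβ : (α = 0 ∧ β = 0) ∨
      (α ≠ 0 ∧ β ≠ 0 ∧ α ≠ β ∧ β + 2 * α ≠ 0 ∧ 5 * β - 2 * α ≠ 0)) :
    ∃ R : Entry, Nonempty (L ≃ₗ⁅ℝ⁆ R.Algebra) := by
  rcases hαβ with ⟨rfl, rfl⟩ | ⟨hα, hβ, hne, h₁, h₂⟩
  · exact h.exists_entry_of_eq_zero hd
  by_cases h2 : α = 2 * β
  · subst h2
    exact h.exists_entry_of_eq_two_mul hd hβ
  have hne' : β - α ≠ 0 := sub_ne_zero.mpr (Ne.symm hne)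
  have h2' : 2 * β - α ≠ 0 := sub_ne_zero.mpr (Ne.symm h2)
  -- ν is found from the ratio α/β = -(3ν + 1)/2 of `g80`. The conditions that ν, ν + 1, ν + 2, 3ν +
  -- 1 and 3ν + 5 be nonzero are exactly the excluded ratios together with α ≠ 2β.
  obtain ⟨ν, hν⟩ : ∃ ν, ν = -(β + 2 * α) / (3 * β) := ⟨_, rfl⟩
  have e1 : ν + 1 = 2 * (β - α) / (3 * β) := by rw [hν]; field_simp; ring
  have e2 : ν + 2 = (5 * β - 2 * α) / (3 * β) := by rw [hν]; field_simp; ring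
  have e3 : 3 * ν + 1 = -(2 * α / β) := by rw [hν]; field_simp; ring
  have e5 : 3 * ν + 5 = 2 * (2 * β - α) / β := by rw [hν]; field_simp; ring
  have h' := h.scale one_ne_zero (q := (β + 2 * α) / (α * (5 * β - 2 * α))) (by positivity)
  rw [one_pow, div_one, show (β + 2 * α) / (α * (5 * β - 2 * α)) * α = -ν / (ν + 2) by
      rw [e2, hν]; field_simp,
    show (β + 2 * α) / (α * (5 * β - 2 * α)) * β = 2 * ν / ((3 * ν + 1) * (ν + 2)) by
      rw [e3, e2, hν]; field_simp] at h'
  refine h'.exists_entry_of_parameter ?_ ?_ ?_ ?_ ?_ hd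
  · rw [hν]; exact div_ne_zero (neg_ne_zero.mpr h₁) (by positivity)
  · rw [e1]; positivity
  · rw [e2]; positivity
  · rw [e3]; simp [hα, hβ]
  · rw [e5]; positivity

end Classification

/-- The Lie algebra of a symplectic filiform Lie algebra of dimension eight is in the list. -/
theorem IsFiliform.exists_entry {L : Type*} [LieRing L] [LieAlgebra ℝ L] (hL : IsFiliform L)
    (hd : Module.finrank ℝ L = 8) {w : LinearMap.BilinForm ℝ L} (hw : IsSymplecticForm w) :
    ∃ R : Entry, Nonempty (L ≃ₗ⁅ℝ⁆ R.Algebra) := by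
  obtain ⟨X, α, β, a₅, a₆, a₇, δ, h⟩ := hL.exists_isFiliformChain hd hw
  exact h.exists_entry hd (h.eq_zero_or_ne_zero hd hw)

end SympFiliform

end

theorem mainTheorem2 :
    (∀ (G : Type*) [TopologicalSpace G] [ChartedSpace (EuclideanSpace ℝ (Fin 8)) G] [Group G]
        [LieGroup (𝓡 8) ∞ G] [ConnectedSpace G] [SimplyConnectedSpace G]
        (Ω : ∀ g : G, LinearMap.BilinForm ℝ (TangentSpace (𝓡 8) g)),
        SympFiliform.IsLeftInvariantSymplecticForm Ω →
        SympFiliform.IsFiliform (GroupLieAlgebra (𝓡 8) G) →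
        ∃ R : SympFiliform.Entry, Nonempty (GroupLieAlgebra (𝓡 8) G ≃ₗ⁅ℝ⁆ R.Algebra)) ∧
    ∀ R : SympFiliform.Entry,
      SympFiliform.IsFiliform R.Algebra ∧ SympFiliform.IsSymplecticForm R.form := by
  refine ⟨fun G _ _ _ _ _ _ Ω hΩ hG => ?_, fun R => ⟨R.isFiliform, R.isSymplecticForm_form⟩⟩
  exact hG.exists_entry (finrank_euclideanSpace_fin (𝕜 := ℝ) (n := 8)) hΩ.isSymplecticForm_one
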